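/- Let $k\ge 2$ be an integer, let $0<\varepsilon<1/k$, and let $p=p(n)\in[0,1]$ satisfy $p(n)\ge n^{-1/k+\varepsilon}$ for all sufficiently large $n$ and $p(n)=o(1)$. Let $f=f(n)$ be non-negative integers with $f(n)\le \varepsilon n/(60k)$ for all sufficiently large $n$. For each $n$ and each $i=1,\dots,f$ let $A_i=A_i(n)$ and $B_i=B_i(n)$ be sequences, each consisting of $k$ distinct vertices in $[n]$, such that, for all sufficiently large $n$, these $2f$ sequences are pairwise disjoint. Then, with probability tending to $1$ as $n\to\infty$, the binomial random graph $G_{n,p}$ on $[n]$ contains pairwise vertex-disjoint subgraphs $R_1,\dots,R_f$ such that, for all $i=1,\dots,f$, $R_i$ is an $(A_i,B_i)$-linkage with at most $\lceil 30k/\varepsilon\rceil$ vertices. Here the $k$th power of a graph $G$ is the graph on $V(G)$ in which two distinct vertices are adjacent if and only if their distance in $G$ is at most $k$. For two disjoint sequences $A=(a_1,\dots,a_k)$ and $B=(b_1,\dots,b_k)$ of distinct vertices, an $(A,B)$-linkage is a graph obtained as follows: take the $k$th power of a path $x_1x_2\dots x_m$ with $m\ge 2k$, $(x_1,\dots,x_k)=A$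 and $(x_{m-k+1},\dots,x_m)=B$, and delete all edges with both ends in $A$ and all edges with both ends in $B$. -/

import Mathlib

open Filter Topology

/-- The `k`th power of a graph `G`: the same vertex set, and two distinct vertices are joined
if and only if their distance in `G` is at most `k`. The extended distance is used, so vertices
in different components (at distance `⊤`) are never joined. -/
def graphPower {V : Type*} (G : SimpleGraph V) (k : ℕ) : SimpleGraph V where
  Adj u v := u ≠ v ∧ G.edist u v ≤ (k : ℕ∞)
  symm := ⟨fun u v h => ⟨h.1.symm, by rw [SimpleGraph.edist_comm]; exact h.2⟩⟩
  loopless := ⟨fun _ h => h.1 rfl⟩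

/-- The subgraph `R` of `G` is an `(A, B)`-linkage: there is a path `x₀ x₁ … x_{m-1}` on `m ≥ 2k`
distinct vertices of `V` (the map `x`) such that its `k`th power has initial endsequence `A` and
final endsequence `B`, and `R` is this `k`th power with all edges within `A` and all edges
within `B` removed. The path itself and the removed edges need not be in `G`. -/
def IsLinkage {V : Type*} {G : SimpleGraph V} {k : ℕ} (A B : Fin k → V) (R : G.Subgraph) : Prop :=
  ∃ (m : ℕ) (hm : 2 * k ≤ m) (x : Fin m ↪ V),
    (∀ j : Fin k, x ⟨j, by have := j.isLt; omega⟩ = A j) ∧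
    (∀ j : Fin k, x ⟨m - k + j, by have := j.isLt; omega⟩ = B j) ∧
    R.verts = Set.range x ∧
    ∀ u v : V, R.Adj u v ↔
      ((graphPower (SimpleGraph.pathGraph m) k).map x).Adj u v ∧
        ¬ (u ∈ Set.range A ∧ v ∈ Set.range A) ∧
        ¬ (u ∈ Set.range B ∧ v ∈ Set.range B)

/-- `(A₁, B₁), …, (A_f, B_f)` are pairs of `k`-sequences: each of the `2f` sequences consists of
`k` distinct vertices, and these `2f` sequences are pairwise disjoint. -/
def AreDisjointSequencePairs {V : Type*} {f k : ℕ} (A B : Fin f → Fin k → V) : Prop :=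
  (∀ a : Fin f ⊕ Fin f, Function.Injective (Sum.elim A B a)) ∧
  Pairwise fun a b : Fin f ⊕ Fin f =>
    Disjoint (Set.range (Sum.elim A B a)) (Set.range (Sum.elim A B b))

/-- `G` contains pairwise (vertex-)disjoint `(A_i, B_i)`-linkages `R_i`, each on at most `s`
vertices. -/
def HasDisjointLinkages {V : Type*} {f k : ℕ} (G : SimpleGraph V) (A B : Fin f → Fin k → V)
    (s : ℕ) : Prop :=
  ∃ R : Fin f → G.Subgraph,
    (∀ i, IsLinkage (A i) (B i) (R i)) ∧
    (∀ i, (R i).verts.ncard ≤ s) ∧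
    Pairwise fun i j => Disjoint (R i).verts (R j).verts

/-! Each linkage gets `m = k * (h + 2)` vertices with `h = ⌈1/ε⌉`: two end blocks and `h` inner
blocks of `k` positions. Each inner position has its own reservoir of linearly many vertices, so
candidate copies can meet only at equal positions.

Apply Janson's inequality to all copies of the linkages with index in a nonempty set `I`: the
probability that none is present is at most `exp (-c |I| n^(kε))` (`prob_no_copy_le`). This requires
that no overlap `J` of two copies be too dense: `N^(inner positions in J) * p^(edges in J)` must be
at least of order `n^(kε)`, and larger by a factor `|I|` if the copies belong to different pairs.
Since `N p^k` has order at least `n^(kε)`, it is enough to have about `k` edges per inner position.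
The ends can cause `k * k` further edges, but only if `J` has at least `h` inner positions, for
otherwise `J` misses a whole inner block; and `h ≥ 1/ε` factors `N p^k` pay for these edges.

The factor `|I|` in the exponent allows a union bound over `I` and over all sets of at most `m M
|I|` deleted vertices, where `M` is about `n^(kε/2)` (`prob_badGraphs_le`). So in a typical graph a
maximal packing leaves at most a fraction `1/M` of the pairs unlinked: otherwise the vertices it
uses could be deleted and one more linkage found (`exists_partial_packing`). Repeating with fresh
reservoirs for the remaining pairs finishes after a bounded number `T` of rounds, once `M ^ T > f`
(`exists_packing`). The failure probabilities of the rounds are simply added, so one random graph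
serves all rounds and no independence between them is needed. -/

section ProductCube

/-! ### Harris' and Janson's inequalities on the product cube. -/

open Finset

variable {α ι : Type*} [DecidableEq α]

/-- The number of sets `D a`, `a ∈ s`, contained in `S`. -/
noncomputable def hitCount (s : Finset ι) (D : ι → Finset α) (S : Finset α) : ℝ :=
  ∑ a ∈ s, if D a ⊆ S then 1 else 0

theorem hitCount_mono (s : Finset ι) (D : ι → Finset α) : Monotone (hitCount s D) := by
  intro S T hST
  refine sum_le_sum fun a _ => ?_
  by_cases h : D a ⊆ S
  · simp [h, h.trans hST]
  · simp only [h, if_false]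
    split_ifs <;> norm_num

theorem hitCount_nonneg (s : Finset ι) (D : ι → Finset α) (S : Finset α) : 0 ≤ hitCount s D S :=
  sum_nonneg fun a _ => by split_ifs <;> norm_num

theorem antitone_exp_neg_hitCount {t : ℝ} (ht : 0 ≤ t) (s : Finset ι) (D : ι → Finset α) :
    Antitone fun S => Real.exp (-(t * hitCount s D S)) := by
  intro S T hST
  have := mul_le_mul_of_nonneg_left (hitCount_mono s D hST) ht
  exact Real.exp_le_exp.2 (by linarith)

variable [Fintype α]

/-- The probability that the random subset of `α` containing each `e` independently with
probability `p e` is equal to `S`. -/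
noncomputable def cubeWeight (p : α → ℝ) (S : Finset α) : ℝ :=
  (∏ e ∈ S, p e) * ∏ e ∈ Sᶜ, (1 - p e)

theorem cubeWeight_nonneg {p : α → ℝ} (h0 : ∀ e, 0 ≤ p e) (h1 : ∀ e, p e ≤ 1) (S : Finset α) :
    0 ≤ cubeWeight p S :=
  mul_nonneg (prod_nonneg fun e _ => h0 e) (prod_nonneg fun e _ => sub_nonneg.2 (h1 e))

theorem sum_cubeWeight (p : α → ℝ) : ∑ S, cubeWeight p S = 1 := by
  have h := Finset.prod_add (fun e => p e) (fun e => 1 - p e) (univ : Finset α)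
  simp only [add_sub_cancel, prod_const_one, powerset_univ] at h
  rw [h]
  rfl

theorem cubeWeight_mul (p : α → ℝ) (S T : Finset α) :
    cubeWeight p S * cubeWeight p T = cubeWeight p (S ∩ T) * cubeWeight p (S ∪ T) := by
  have h1 := Finset.prod_union_inter (s₁ := S) (s₂ := T) (f := fun e => p e)
  have h2 := Finset.prod_union_inter (s₁ := Sᶜ) (s₂ := Tᶜ) (f := fun e => 1 - p e)
  rw [← compl_inter, ← compl_union] at h2
  unfold cubeWeight
  calc _ = ((∏ e ∈ S, p e) * ∏ e ∈ T, p e) *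
        ((∏ e ∈ Sᶜ, (1 - p e)) * ∏ e ∈ Tᶜ, (1 - p e)) := by ring
    _ = _ := by rw [← h1, ← h2]; ring

/-- **Harris' inequality** for two decreasing functions. -/
theorem harris_antitone {p : α → ℝ} (h0 : ∀ e, 0 ≤ p e) (h1 : ∀ e, p e ≤ 1)
    {f g : Finset α → ℝ} (hf0 : ∀ S, 0 ≤ f S) (hg0 : ∀ S, 0 ≤ g S)
    (hf : Antitone f) (hg : Antitone g) :
    (∑ S, cubeWeight p S * f S) * (∑ S, cubeWeight p S * g S) ≤
      ∑ S, cubeWeight p S * (f S * g S) := by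
  -- The order dual turns decreasing functions into increasing ones; the lattice condition holds
  -- with equality by `cubeWeight_mul`.
  have h := fkg (α := (Finset α)ᵒᵈ) (β := ℝ) (f := fun S => f S.ofDual) (g := fun S => g S.ofDual)
    (μ := fun S => cubeWeight p S.ofDual)
    (fun S => cubeWeight_nonneg h0 h1 _) (fun S => hf0 _) (fun S => hg0 _)
    (fun S T hST => hf hST) (fun S T hST => hg hST)
    (fun S T => by
      have := cubeWeight_mul p S.ofDual T.ofDual
      rw [this, mul_comm]
      exact le_rfl)
  have hs : ∑ S : (Finset α)ᵒᵈ, cubeWeight p S.ofDual = 1 := sum_cubeWeight p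
  rw [hs, one_mul] at h
  exact h

theorem sum_cubeWeight_mem (p : α → ℝ) (e : α) (g : Finset α → ℝ) :
    ∑ S, cubeWeight p S * (if e ∈ S then g S else 0) =
      p e * ∑ S, cubeWeight p S * g (insert e S) := by
  have hu : (univ : Finset (Finset α)) = (insert e (univ.erase e)).powerset := by
    rw [insert_erase (mem_univ e), powerset_univ]
  have hw : ∀ T ∈ (univ.erase e).powerset,
      cubeWeight p (insert e T) = p e * ((∏ x ∈ T, p x) * ∏ x ∈ (insert e T)ᶜ, (1 - p x)) ∧
      cubeWeight p T = (1 - p e) * ((∏ x ∈ T, p x) * ∏ x ∈ (insert e T)ᶜ, (1 - p x)) := by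
    intro T hT
    have heT : e ∉ T := fun h => by simpa using (mem_powerset.1 hT) h
    refine ⟨by rw [cubeWeight, prod_insert heT, mul_assoc], ?_⟩
    have : Tᶜ = insert e (insert e T)ᶜ := by
      ext x
      simp only [mem_compl, mem_insert, not_or]
      by_cases hx : x = e
      · simp [hx, heT]
      · simp [hx]
    rw [cubeWeight, this, prod_insert (by simp)]
    ring
  rw [hu, sum_powerset_insert (by simp), sum_powerset_insert (by simp), mul_add, mul_sum, mul_sum,
    ← sum_add_distrib, ← sum_add_distrib]
  refine sum_congr rfl fun T hT => ?_
  have heT : e ∉ T := fun h => by simpa using (mem_powerset.1 hT) h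
  rw [(hw T hT).1, (hw T hT).2, if_neg heT, if_pos (mem_insert_self e T), insert_idem]
  ring

/-- By independence, conditioning on `D ⊆ S` amounts to adding `D` to `S`. -/
theorem sum_cubeWeight_subset (p : α → ℝ) (D : Finset α) :
    ∀ g : Finset α → ℝ, ∑ S, cubeWeight p S * (if D ⊆ S then g S else 0) =
      (∏ e ∈ D, p e) * ∑ S, cubeWeight p S * g (S ∪ D) := by
  induction D using Finset.induction_on with
  | empty => intro g; simp
  | insert e D he ih =>
    intro g
    have h1 := sum_cubeWeight_mem p e (fun S => if D ⊆ S then g S else 0)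
    have h2 := ih (fun S => g (insert e S))
    have h3 : ∀ S, (if insert e D ⊆ S then g S else 0) =
        if e ∈ S then (if D ⊆ S then g S else 0) else 0 := by
      intro S
      simp only [insert_subset_iff, ite_and]
    have h4 : ∀ S, (if D ⊆ insert e S then g (insert e S) else 0) =
        if D ⊆ S then g (insert e S) else 0 := by
      intro S
      simp only [subset_insert_iff_of_notMem he]
    simp only [h3, h1, h4, h2, prod_insert he, union_insert]
    ring

theorem sum_cubeWeight_indicator (p : α → ℝ) (D : Finset α) :
    ∑ S, cubeWeight p S * (if D ⊆ S then 1 else 0) = ∏ e ∈ D, p e := by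
  rw [sum_cubeWeight_subset p D (fun _ => 1)]
  simp [sum_cubeWeight]

open Classical in
-- The hit count splits into the sets meeting `D a` and the rest. Conditioning on `D a ⊆ S` does not
-- affect the rest, and Harris' inequality separates the two exponentials. The first is bounded
-- below by `1 - x ≤ exp (-x)`; dropping the sets meeting `D a` only increases the second beyond the
-- full Laplace transform.
theorem le_sum_subset_exp {p : α → ℝ} (h0 : ∀ e, 0 ≤ p e) (h1 : ∀ e, p e ≤ 1)
    (s : Finset ι) (D : ι → Finset α) (a : ι) {t : ℝ} (ht : 0 ≤ t) :
    (∏ e ∈ D a, p e - t * ∑ b ∈ s with ¬ Disjoint (D a) (D b), ∏ e ∈ D a ∪ D b, p e) *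
      (∑ S, cubeWeight p S * Real.exp (-(t * hitCount s D S))) ≤
    ∑ S, cubeWeight p S * (if D a ⊆ S then Real.exp (-(t * hitCount s D S)) else 0) := by
  set P := ∏ e ∈ D a, p e
  have hP : 0 ≤ P := prod_nonneg fun e _ => h0 e
  set ψ := ∑ S, cubeWeight p S * Real.exp (-(t * hitCount s D S))
  set s₁ := s.filter fun b => ¬ Disjoint (D a) (D b)
  set s₂ := s.filter fun b => ¬ ¬ Disjoint (D a) (D b)
  have hsplit : ∀ S, hitCount s D S = hitCount s₁ D S + hitCount s₂ D S := fun S =>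
    (sum_filter_add_sum_filter_not s _ _).symm
  have hw := cubeWeight_nonneg h0 h1
  have hψ : 0 ≤ ψ := sum_nonneg fun S _ => mul_nonneg (hw S) (Real.exp_pos _).le
  have hZ : ∀ S, hitCount s₂ D (S ∪ D a) = hitCount s₂ D S := by
    intro S
    refine sum_congr rfl fun b hb => ?_
    have hd : Disjoint (D b) (D a) := (not_not.1 (mem_filter.1 hb).2).symm
    have : D b ⊆ S ∪ D a ↔ D b ⊆ S := by
      refine ⟨fun h x hx => ?_, fun h => h.trans subset_union_left⟩
      exact (mem_union.1 (h hx)).resolve_right fun hxa => (Finset.disjoint_left.1 hd) hx hxa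
    simp [this]
  have hψZ : ψ ≤ ∑ S, cubeWeight p S * Real.exp (-(t * hitCount s₂ D S)) := by
    refine sum_le_sum fun S _ => mul_le_mul_of_nonneg_left (Real.exp_le_exp.2 ?_) (hw S)
    have := mul_nonneg ht (hitCount_nonneg s₁ D S)
    rw [hsplit S]
    linarith
  have hY0 : 0 ≤ ∑ S, cubeWeight p S * Real.exp (-(t * hitCount s₁ D (S ∪ D a))) :=
    sum_nonneg fun S _ => mul_nonneg (hw S) (Real.exp_pos _).le
  have hYlow : P - t * ∑ b ∈ s₁, ∏ e ∈ D a ∪ D b, p e ≤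
      P * ∑ S, cubeWeight p S * Real.exp (-(t * hitCount s₁ D (S ∪ D a))) := by
    rw [← sum_cubeWeight_subset p (D a) fun S => Real.exp (-(t * hitCount s₁ D S))]
    have : P - t * ∑ b ∈ s₁, ∏ e ∈ D a ∪ D b, p e =
        ∑ S, cubeWeight p S * (if D a ⊆ S then 1 - t * hitCount s₁ D S else 0) := by
      have e1 : ∀ S, cubeWeight p S * (if D a ⊆ S then 1 - t * hitCount s₁ D S else 0) =
          cubeWeight p S * (if D a ⊆ S then 1 else 0) -
            t * ∑ b ∈ s₁, cubeWeight p S * (if D a ∪ D b ⊆ S then 1 else 0) := by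
        intro S
        by_cases h : D a ⊆ S
        · simp only [h, if_true, union_subset_iff, true_and, hitCount, ← mul_sum]
          ring
        · simp [h, union_subset_iff]
      simp only [e1, sum_sub_distrib, ← mul_sum]
      rw [sum_cubeWeight_indicator]
      congr 2
      simp only [mul_sum]
      rw [sum_comm]
      exact sum_congr rfl fun b _ => (sum_cubeWeight_indicator p _).symm
    rw [this]
    refine sum_le_sum fun S _ => mul_le_mul_of_nonneg_left ?_ (hw S)
    split_ifs
    · have := Real.add_one_le_exp (-(t * hitCount s₁ D S))
      linarith
    · exact le_rfl
  have hharris := harris_antitone h0 h1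
    (f := fun S => Real.exp (-(t * hitCount s₁ D (S ∪ D a))))
    (g := fun S => Real.exp (-(t * hitCount s₂ D S)))
    (fun S => (Real.exp_pos _).le) (fun S => (Real.exp_pos _).le)
    (fun S T hST => antitone_exp_neg_hitCount ht s₁ D (union_subset_union_left hST))
    (antitone_exp_neg_hitCount ht s₂ D)
  calc _ ≤ (P * ∑ S, cubeWeight p S * Real.exp (-(t * hitCount s₁ D (S ∪ D a)))) * ψ :=
        mul_le_mul_of_nonneg_right hYlow hψ
    _ ≤ P * ((∑ S, cubeWeight p S * Real.exp (-(t * hitCount s₁ D (S ∪ D a)))) *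
          ∑ S, cubeWeight p S * Real.exp (-(t * hitCount s₂ D S))) := by
        rw [mul_assoc]
        exact mul_le_mul_of_nonneg_left (mul_le_mul_of_nonneg_left hψZ hY0) hP
    _ ≤ P * ∑ S, cubeWeight p S * Real.exp (-(t * hitCount s D (S ∪ D a))) := by
        refine mul_le_mul_of_nonneg_left (hharris.trans_eq ?_) hP
        refine sum_congr rfl fun S _ => ?_
        simp only [hsplit, hZ, mul_add, neg_add, Real.exp_add]
    _ = _ := (sum_cubeWeight_subset p (D a) fun S => Real.exp (-(t * hitCount s D S))).symm

open Classical in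
/-- **Janson's inequality** for the probability that no `D a` is contained in a random set. -/
theorem janson {p : α → ℝ} (h0 : ∀ e, 0 ≤ p e) (h1 : ∀ e, p e ≤ 1)
    (s : Finset ι) (D : ι → Finset α) {μ Δ : ℝ} (hμ : μ = ∑ a ∈ s, ∏ e ∈ D a, p e)
    (hΔ : ∑ a ∈ s, ∑ b ∈ s with ¬ Disjoint (D a) (D b), ∏ e ∈ D a ∪ D b, p e ≤ Δ)
    (hΔ0 : 0 < Δ) :
    ∑ S with ∀ a ∈ s, ¬ D a ⊆ S, cubeWeight p S ≤ Real.exp (-(μ ^ 2 / (2 * Δ))) := by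
  have hw := cubeWeight_nonneg h0 h1
  have hμ0 : 0 ≤ μ := by
    rw [hμ]
    exact sum_nonneg fun a _ => prod_nonneg fun e _ => h0 e
  set ψ : ℝ → ℝ := fun t => ∑ S, cubeWeight p S * Real.exp (-(t * hitCount s D S)) with hψ
  have hψ0 : ∀ t, 0 ≤ ψ t := fun t => sum_nonneg fun S _ => mul_nonneg (hw S) (Real.exp_pos _).le
  have hder : ∀ t, HasDerivAt ψ
      (-∑ S, cubeWeight p S * (hitCount s D S * Real.exp (-(t * hitCount s D S)))) t := by
    intro t
    rw [← sum_neg_distrib]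
    refine HasDerivAt.fun_sum fun S _ => ?_
    have h2 : HasDerivAt (fun t : ℝ => -(t * hitCount s D S)) (-(1 * hitCount s D S)) t :=
      ((hasDerivAt_id t).mul_const _).neg
    exact ((h2.exp).const_mul (cubeWeight p S)).congr_deriv (by ring)
  have hψ' : ∀ t, 0 ≤ t → (μ - t * Δ) * ψ t ≤
      ∑ S, cubeWeight p S * (hitCount s D S * Real.exp (-(t * hitCount s D S))) := by
    intro t ht
    have h2 := sum_le_sum fun a (_ : a ∈ s) => le_sum_subset_exp h0 h1 s D a ht
    rw [← sum_mul, sum_sub_distrib, ← mul_sum, ← hμ, sum_comm] at h2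
    have h3 : ∑ S, ∑ a ∈ s, cubeWeight p S *
        (if D a ⊆ S then Real.exp (-(t * hitCount s D S)) else 0) =
        ∑ S, cubeWeight p S * (hitCount s D S * Real.exp (-(t * hitCount s D S))) := by
      refine sum_congr rfl fun S _ => ?_
      rw [← mul_sum]
      congr 1
      rw [hitCount, sum_mul]
      exact sum_congr rfl fun a _ => by split_ifs <;> simp
    rw [h3] at h2
    refine le_trans (mul_le_mul_of_nonneg_right ?_ (hψ0 t)) h2
    have := mul_le_mul_of_nonneg_left hΔ ht
    linarith
  -- `hψ'` is a differential inequality for the Laplace transform, and this is its integrating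
  -- factor. The exponent `μ t - Δ t² / 2` is largest at `t = μ / Δ`, the point used below.
  set F : ℝ → ℝ := fun t => ψ t * Real.exp (μ * t - Δ * t ^ 2 / 2) with hF
  have hFder : ∀ t, HasDerivAt F
      ((-∑ S, cubeWeight p S * (hitCount s D S * Real.exp (-(t * hitCount s D S)))) *
        Real.exp (μ * t - Δ * t ^ 2 / 2) +
        ψ t * (Real.exp (μ * t - Δ * t ^ 2 / 2) * (μ - Δ * t))) t := by
    intro t
    refine (hder t).mul ?_
    have h2 : HasDerivAt (fun t : ℝ => μ * t - Δ * t ^ 2 / 2) (μ - Δ * t) t := by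
      have h3 : HasDerivAt (fun t : ℝ => μ * t - Δ * t ^ 2 / 2)
          (μ * 1 - Δ * ((2 : ℕ) * t ^ (2 - 1)) / 2) t :=
        ((hasDerivAt_id' t).const_mul μ).sub (((hasDerivAt_pow 2 t).const_mul Δ).div_const 2)
      exact h3.congr_deriv (by norm_num; ring)
    exact h2.exp
  have hanti : AntitoneOn F (Set.Ici 0) := by
    refine antitoneOn_of_deriv_nonpos (convex_Ici 0)
      (fun t _ => (hFder t).continuousAt.continuousWithinAt)
      (fun t _ => (hFder t).differentiableAt.differentiableWithinAt) fun t ht => ?_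
    rw [interior_Ici] at ht
    rw [(hFder t).deriv]
    have h2 := hψ' t (le_of_lt ht)
    have h3 := mul_le_mul_of_nonneg_left h2 (Real.exp_pos (μ * t - Δ * t ^ 2 / 2)).le
    linarith
  have hF0 : F 0 = 1 := by simp [hF, hψ, sum_cubeWeight]
  have ht0 : 0 ≤ μ / Δ := div_nonneg hμ0 hΔ0.le
  have hle := hanti (Set.mem_Ici.2 le_rfl) (Set.mem_Ici.2 ht0) ht0
  rw [hF0] at hle
  have hlow : ∑ S with ∀ a ∈ s, ¬ D a ⊆ S, cubeWeight p S ≤ ψ (μ / Δ) := by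
    rw [sum_filter]
    refine sum_le_sum fun S _ => ?_
    split_ifs with h
    · have : hitCount s D S = 0 := sum_eq_zero fun a ha => by simp [h a ha]
      simp [this]
    · exact mul_nonneg (hw S) (Real.exp_pos _).le
  refine hlow.trans ?_
  have he : μ * (μ / Δ) - Δ * (μ / Δ) ^ 2 / 2 = μ ^ 2 / (2 * Δ) := by
    field_simp
    ring
  simp only [hF, he] at hle
  rw [Real.exp_neg, ← one_div, le_div_iff₀ (Real.exp_pos _)]
  exact hle

end ProductCube

/-! ### Transfer to the binomial random graph. -/

section RandomGraph

open Finset MeasureTheory ProbabilityTheory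

variable {V ι : Type*}

/-- The edge probabilities of the binomial random graph, as a function on all unordered pairs. -/
noncomputable def edgeProb (q : ℝ) (e : Sym2 V) : ℝ := by
  classical exact if e.IsDiag then 0 else q

theorem prod_edgeProb {q : ℝ} {D : Finset (Sym2 V)} (hD : ∀ e ∈ D, ¬ e.IsDiag) :
    ∏ e ∈ D, edgeProb q e = q ^ #D := by
  rw [← prod_const]
  exact prod_congr rfl fun e he => by simp [edgeProb, hD e he]

variable [Fintype V] [DecidableEq V]

/-- Loops have probability 0 in `edgeProb`, so they contribute factors 1 when absent and make the
weight vanish when present. -/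
theorem setBernoulli_real_singleton_eq_cubeWeight (p : unitInterval) (F : Finset (Sym2 V)) :
    (setBernoulli (Sym2.diagSetᶜ : Set (Sym2 V)) p).real {(F : Set (Sym2 V))} =
      cubeWeight (edgeProb (p : ℝ)) F := by
  classical
  by_cases hF : (F : Set (Sym2 V)) ⊆ Sym2.diagSetᶜ
  · rw [setBernoulli_real_singleton p hF (Set.toFinite _), cubeWeight,
      prod_edgeProb (fun e he => by simpa using hF he), Set.ncard_coe_finset]
    congr 1
    have h1 : (Sym2.diagSetᶜ \ (F : Set (Sym2 V))) =
        ((Fᶜ.filter fun e => ¬ e.IsDiag : Finset (Sym2 V)) : Set (Sym2 V)) := by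
      ext e
      simp [and_comm]
    rw [h1, Set.ncard_coe_finset, ← prod_const, prod_filter]
    refine prod_congr rfl fun e _ => ?_
    by_cases he : e.IsDiag <;> simp [edgeProb, he]
  · rw [measureReal_def, setBernoulli_singleton_of_not_subset p hF]
    obtain ⟨e, he, hd⟩ := Set.not_subset.1 hF
    have hd' : e.IsDiag := by simpa using hd
    rw [cubeWeight, prod_eq_zero (i := e) (by simpa using he) (by simp [edgeProb, hd'])]
    simp

open Classical in
/-- **Janson's inequality** for the binomial random graph. -/
theorem janson_binomialRandom (p : unitInterval) (s : Finset ι) (D : ι → Finset (Sym2 V))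
    (hD : ∀ a ∈ s, ∀ e ∈ D a, ¬ e.IsDiag) {μ Δ : ℝ} (hμ : μ = ∑ a ∈ s, (p : ℝ) ^ #(D a))
    (hΔ : ∑ a ∈ s, ∑ b ∈ s with ¬ Disjoint (D a) (D b), (p : ℝ) ^ #(D a ∪ D b) ≤ Δ)
    (hΔ0 : 0 < Δ) :
    (SimpleGraph.binomialRandom V p).real
        {G : SimpleGraph V | ∀ a ∈ s, ¬ (D a : Set (Sym2 V)) ⊆ G.edgeSet} ≤
      Real.exp (-(μ ^ 2 / (2 * Δ))) := by
  set T := {G : SimpleGraph V | ∀ a ∈ s, ¬ (D a : Set (Sym2 V)) ⊆ G.edgeSet}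
  have hp0 : ∀ e : Sym2 V, 0 ≤ edgeProb (p : ℝ) e := fun e => by
    unfold edgeProb; split_ifs; exacts [le_rfl, p.2.1]
  have hp1 : ∀ e : Sym2 V, edgeProb (p : ℝ) e ≤ 1 := fun e => by
    unfold edgeProb; split_ifs; exacts [zero_le_one, p.2.2]
  have hsub : SimpleGraph.edgeSet '' T ⊆
      ⋃ F ∈ (univ.filter fun F : Finset (Sym2 V) => ∀ a ∈ s, ¬ D a ⊆ F), {(F : Set (Sym2 V))} := by
    rintro _ ⟨G, hG, rfl⟩
    simp only [Set.mem_iUnion, Set.mem_singleton_iff, mem_filter, mem_univ, true_and]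
    refine ⟨G.edgeFinset, fun a ha h => hG a ha ?_, by simp⟩
    rw [← SimpleGraph.coe_edgeFinset]
    exact_mod_cast h
  calc (SimpleGraph.binomialRandom V p).real T
      = (setBernoulli (Sym2.diagSetᶜ : Set (Sym2 V)) p).real (SimpleGraph.edgeSet '' T) := by
        rw [measureReal_def, SimpleGraph.binomialRandom_apply', measureReal_def]
    _ ≤ _ := measureReal_mono hsub (measure_ne_top _ _)
    _ ≤ _ := measureReal_biUnion_finset_le _ _
    _ = ∑ F with ∀ a ∈ s, ¬ D a ⊆ F, cubeWeight (edgeProb (p : ℝ)) F :=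
        sum_congr rfl fun F _ => setBernoulli_real_singleton_eq_cubeWeight p F
    _ ≤ _ := by
        refine janson hp0 hp1 s D (hμ.trans (sum_congr rfl fun a ha => ?_))
          (le_trans (sum_le_sum fun a ha => ?_) hΔ) hΔ0
        · rw [prod_edgeProb (hD a ha)]
        · refine le_of_eq (sum_congr rfl fun b hb => ?_)
          rw [prod_edgeProb]
          intro e he
          rcases mem_union.1 he with h | h
          · exact hD a ha e h
          · exact hD b (mem_filter.1 hb).1 e h

end RandomGraph

/-! ### Edge counts within sets of positions. -/

section LinkagePattern

open Finset

/-- The inner positions of a linkage on `m` vertices: all but the first `k` and the last `k`. -/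
def innerPos (k m : ℕ) : Finset (Fin m) := univ.filter fun u => k ≤ u.val ∧ u.val + k < m

/-- The edges of a linkage on `m` vertices lying within the set `J` of positions. -/
def patternEdges (k m : ℕ) (J : Finset (Fin m)) : Finset (Fin m × Fin m) :=
  univ.filter fun e => e.1 ∈ J ∧ e.2 ∈ J ∧ e.1.val < e.2.val ∧ e.2.val ≤ e.1.val + k ∧
    k ≤ e.2.val ∧ e.1.val + k < m

variable {k m : ℕ}

theorem mem_innerPos {u : Fin m} : u ∈ innerPos k m ↔ k ≤ u.val ∧ u.val + k < m := by
  simp [innerPos]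

theorem mem_patternEdges {J : Finset (Fin m)} {e : Fin m × Fin m} :
    e ∈ patternEdges k m J ↔ e.1 ∈ J ∧ e.2 ∈ J ∧ e.1.val < e.2.val ∧ e.2.val ≤ e.1.val + k ∧
      k ≤ e.2.val ∧ e.1.val + k < m := by
  simp [patternEdges]

/-- Edge lengths lie between 1 and `k`, so a position is charged at most `k` times if charge and
length determine the edge. -/
theorem card_patternEdges_le_of_charge (J : Finset (Fin m)) (C : Finset (Fin m))
    (c : Fin m × Fin m → Fin m) (hc : ∀ e ∈ patternEdges k m J, c e ∈ C)
    (hinj : ∀ e ∈ patternEdges k m J, ∀ e' ∈ patternEdges k m J, c e = c e' →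
      e.2.val - e.1.val = e'.2.val - e'.1.val → e = e') :
    #(patternEdges k m J) ≤ k * #C := by
  calc #(patternEdges k m J) ≤ #(C ×ˢ range k) := by
        refine card_le_card_of_injOn (fun e => (c e, e.2.val - e.1.val - 1)) ?_ ?_
        · intro e he
          have h := mem_patternEdges.1 he
          simp only [coe_product, Set.mem_prod, mem_coe, mem_range]
          exact ⟨hc e he, by omega⟩
        · intro e he e' he' hee
          have h := mem_patternEdges.1 he
          have h' := mem_patternEdges.1 he'
          simp only [Prod.mk.injEq] at hee
          exact hinj e he e' he' hee.1 (by omega)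
    _ = k * #C := by rw [card_product, card_range, mul_comm]

theorem eq_of_snd_eq {J : Finset (Fin m)} {e e' : Fin m × Fin m} (he : e ∈ patternEdges k m J)
    (he' : e' ∈ patternEdges k m J) (h : e.2 = e'.2)
    (hd : e.2.val - e.1.val = e'.2.val - e'.1.val) : e = e' := by
  have h1 := mem_patternEdges.1 he
  have h2 := mem_patternEdges.1 he'
  have h3 := congrArg Fin.val h
  exact Prod.ext (Fin.ext (by omega)) h

/-- Charge each edge to its upper end; the minimum of `J` is never charged. -/
theorem card_patternEdges_le_of_nonempty {J : Finset (Fin m)} (hJ : J.Nonempty) :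
    #(patternEdges k m J) ≤ k * (#J - 1) := by
  rw [← card_erase_of_mem (J.min'_mem hJ)]
  refine card_patternEdges_le_of_charge J _ (fun e => e.2) (fun e he => ?_)
    fun e he e' he' => eq_of_snd_eq he he'
  have h := mem_patternEdges.1 he
  refine mem_erase.2 ⟨fun heq => ?_, h.2.1⟩
  have := J.min'_le e.1 h.1
  rw [← heq] at this
  exact absurd (Fin.le_def.1 this) (by omega)

/-- Upper ends are inner or among the last `k` positions; the latter account for `k * k`. -/
theorem card_patternEdges_le (J : Finset (Fin m)) :
    #(patternEdges k m J) ≤ k * #(J ∩ innerPos k m) + k * k := by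
  have h : #((J ∩ innerPos k m) ∪ univ.filter fun u : Fin m => m ≤ u.val + k) ≤
      #(J ∩ innerPos k m) + k := by
    refine (card_union_le _ _).trans (Nat.add_le_add_left ?_ _)
    calc _ ≤ #(range k) := by
          refine card_le_card_of_injOn (fun u => m - 1 - u.val) ?_ ?_
          · intro u hu
            simp only [coe_filter, mem_univ, true_and, Set.mem_ofPred_eq] at hu
            simp only [coe_range, Set.mem_Iio]
            have := u.2
            omega
          · intro u _ v _ huv
            have := u.2
            have := v.2
            simp only at huv
            exact Fin.ext (by omega)
      _ = k := card_range k
  calc _ ≤ k * #((J ∩ innerPos k m) ∪ univ.filter fun u : Fin m => m ≤ u.val + k) := by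
        refine card_patternEdges_le_of_charge J _ (fun e => e.2) (fun e he => ?_)
          fun e he e' he' => eq_of_snd_eq he he'
        have h := mem_patternEdges.1 he
        simp only [mem_union, mem_inter, mem_innerPos, mem_filter, mem_univ, true_and]
        by_cases hm : e.2.val + k < m
        · exact Or.inl ⟨h.2.1, h.2.2.2.2.1, hm⟩
        · exact Or.inr (by omega)
    _ ≤ k * (#(J ∩ innerPos k m) + k) := Nat.mul_le_mul_left k h
    _ = _ := mul_add _ _ _

/-- No edge jumps over `k` consecutive missing positions. Left of the gap charge the upper end,
right of it the lower end: both are inner, so the term `k * k` disappears. -/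
theorem card_patternEdges_le_of_gap {J : Finset (Fin m)} {c : ℕ} (hcm : c + 2 * k ≤ m)
    (hgap : ∀ u ∈ J, ¬ (c ≤ u.val ∧ u.val < c + k)) :
    #(patternEdges k m J) ≤ k * #(J ∩ innerPos k m) := by
  have key : ∀ e ∈ patternEdges k m J, e.2.val < c ∨ c + k ≤ e.1.val := by
    intro e he
    have h := mem_patternEdges.1 he
    have h1 := hgap e.1 h.1
    have h2 := hgap e.2 h.2.1
    omega
  refine card_patternEdges_le_of_charge J _ (fun e => if e.2.val < c then e.2 else e.1)
    (fun e he => ?_) fun e he e' he' heq hd => ?_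
  · have h := mem_patternEdges.1 he
    have h1 := key e he
    split_ifs with hlt
    · exact mem_inter.2 ⟨h.2.1, mem_innerPos.2 ⟨by omega, by omega⟩⟩
    · exact mem_inter.2 ⟨h.1, mem_innerPos.2 ⟨by omega, by omega⟩⟩
  · have h := mem_patternEdges.1 he
    have h' := mem_patternEdges.1 he'
    have h1 := key e he
    have h1' := key e' he'
    have hv := congrArg Fin.val heq
    split_ifs at hv <;>
    exact Prod.ext (Fin.ext (by omega)) (Fin.ext (by omega))

/-- Fewer than `h` positions cannot meet all `h` inner blocks. -/
theorem exists_gap {h : ℕ} (hk : 0 < k) {J : Finset (Fin (k * (h + 2)))}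
    (hJ : #(J ∩ innerPos k (k * (h + 2))) < h) :
    ∃ c, c + 2 * k ≤ k * (h + 2) ∧ ∀ u ∈ J, ¬ (c ≤ u.val ∧ u.val < c + k) := by
  have hcard : #((J ∩ innerPos k (k * (h + 2))).image fun u => u.val / k) < #(Icc 1 h) := by
    rw [Nat.card_Icc, Nat.add_sub_cancel]
    exact card_image_le.trans_lt hJ
  obtain ⟨b, hb, hbJ⟩ := exists_mem_notMem_of_card_lt_card hcard
  obtain ⟨hb1, hbh⟩ := mem_Icc.1 hb
  have hb2 : k * b ≤ k * h := Nat.mul_le_mul_left k hbh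
  have hb3 : k * 1 ≤ k * b := Nat.mul_le_mul_left k hb1
  have hexp : k * (h + 2) = k * h + 2 * k := by ring
  refine ⟨k * b, by omega, fun u hu hub => hbJ ?_⟩
  refine mem_image.2 ⟨u, mem_inter.2 ⟨hu, mem_innerPos.2 ⟨by omega, by omega⟩⟩, ?_⟩
  rw [Nat.div_eq_iff hk]
  have : b * k = k * b := mul_comm _ _
  constructor <;> omega

theorem card_patternEdges_le_of_card_lt {h : ℕ} (hk : 0 < k) {J : Finset (Fin (k * (h + 2)))}
    (hJ : #(J ∩ innerPos k (k * (h + 2))) < h) :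
    #(patternEdges k (k * (h + 2)) J) ≤ k * #(J ∩ innerPos k (k * (h + 2))) := by
  obtain ⟨c, hcm, hgap⟩ := exists_gap hk hJ
  exact card_patternEdges_le_of_gap hcm hgap

end LinkagePattern

/-! ### Overlaps of copies and the application of Janson's inequality. -/

section CopiesOfPattern

open Finset MeasureTheory

variable {V κ : Type*} {k m N : ℕ}

/-- Vertex sets `W i u` for the position `u` of the `i`th linkage: `N` candidates for each inner
position and one for each other position. -/
structure IsPlacement (k N : ℕ) (W : κ → Fin m → Finset V) : Prop where
  disjoint_pos : ∀ i j u v, u ≠ v → Disjoint (W i u) (W j v)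
  disjoint_ends : ∀ i j, i ≠ j → ∀ u ∉ innerPos k m, Disjoint (W i u) (W j u)
  card_eq : ∀ i u, #(W i u) = if u ∈ innerPos k m then N else 1

namespace IsPlacement

variable {W : κ → Fin m → Finset V}

theorem eq_of_eq (hW : IsPlacement k N W) {i j : κ} {X Y : Fin m → V}
    (hX : X ∈ Fintype.piFinset (W i)) (hY : Y ∈ Fintype.piFinset (W j)) :
    ∀ u v, X u = Y v → u = v := by
  intro u v huv
  by_contra hne
  refine (Finset.disjoint_left.1 (hW.disjoint_pos i j u v hne)) (Fintype.mem_piFinset.1 hX u) ?_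
  rw [huv]
  exact Fintype.mem_piFinset.1 hY v

theorem injective (hW : IsPlacement k N W) {i : κ} {X : Fin m → V}
    (hX : X ∈ Fintype.piFinset (W i)) : Function.Injective X :=
  fun u v h => hW.eq_of_eq hX hX u v h

theorem card_piFinset (hW : IsPlacement k N W) (i : κ) :
    #(Fintype.piFinset (W i)) = N ^ #(innerPos k m) := by
  rw [Fintype.card_piFinset]
  simp only [hW.card_eq, prod_ite_mem, univ_inter, prod_const]

end IsPlacement

variable [DecidableEq V]

/-- The edges of the linkage placed on the vertices `X 0, …, X (m - 1)`. -/
def copyEdges (k : ℕ) {m : ℕ} (X : Fin m → V) : Finset (Sym2 V) :=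
  (patternEdges k m univ).image fun e => s(X e.1, X e.2)

theorem not_isDiag_of_mem_copyEdges {X : Fin m → V} (hX : Function.Injective X) :
    ∀ e ∈ copyEdges k X, ¬ e.IsDiag := by
  intro e he
  obtain ⟨⟨u, v⟩, huv, rfl⟩ := mem_image.1 he
  have h := mem_patternEdges.1 huv
  rw [Sym2.mk_isDiag_iff]
  intro heq
  have := congrArg Fin.val (hX heq)
  simp only at h this
  omega

theorem card_copyEdges {X : Fin m → V} (hX : Function.Injective X) :
    #(copyEdges k X) = #(patternEdges k m univ) := by
  refine card_image_of_injOn ?_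
  rintro ⟨u, v⟩ huv ⟨u', v'⟩ huv' heq
  have h := mem_patternEdges.1 huv
  have h' := mem_patternEdges.1 huv'
  simp only at h h'
  rcases Sym2.eq_iff.1 heq with ⟨h1, h2⟩ | ⟨h1, h2⟩
  · exact Prod.ext (hX h1) (hX h2)
  · have h3 := congrArg Fin.val (hX h1)
    have h4 := congrArg Fin.val (hX h2)
    simp only at h3 h4
    omega

/-- The positions at which two placements agree. -/
def agreeSet (X Y : Fin m → V) : Finset (Fin m) := univ.filter fun u => X u = Y u

/-- A shared edge occupies the same two positions in both copies; the reversed identification is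
impossible because pattern edges are increasing. -/
theorem copyEdges_inter_subset {X Y : Fin m → V} (hXY : ∀ u v, X u = Y v → u = v) :
    copyEdges k X ∩ copyEdges k Y ⊆
      (patternEdges k m (agreeSet X Y)).image fun e => s(X e.1, X e.2) := by
  intro e he
  obtain ⟨he1, he2⟩ := mem_inter.1 he
  obtain ⟨⟨u, v⟩, huv, rfl⟩ := mem_image.1 he1
  obtain ⟨⟨u', v'⟩, huv', heq⟩ := mem_image.1 he2
  have h := mem_patternEdges.1 huv
  have h' := mem_patternEdges.1 huv'
  simp only at h h'
  rcases Sym2.eq_iff.1 heq with ⟨h1, h2⟩ | ⟨h1, h2⟩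
  · have e1 := hXY _ _ h1.symm
    have e2 := hXY _ _ h2.symm
    simp only at e1 e2 h1 h2
    subst e1 e2
    refine mem_image.2 ⟨(u, v), mem_patternEdges.2 ⟨?_, ?_, h.2.2⟩, rfl⟩
    · simp [agreeSet, h1]
    · simp [agreeSet, h2]
  · have h3 := congrArg Fin.val (hXY _ _ h1.symm)
    have h4 := congrArg Fin.val (hXY _ _ h2.symm)
    simp only at h3 h4
    omega

theorem pow_card_union_mul_le {q : ℝ} (h0 : 0 ≤ q) (h1 : q ≤ 1) {X Y : Fin m → V}
    (hX : Function.Injective X) (hY : Function.Injective Y) (hXY : ∀ u v, X u = Y v → u = v) :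
    q ^ #(copyEdges k X ∪ copyEdges k Y) * q ^ #(patternEdges k m (agreeSet X Y)) ≤
      (q ^ #(patternEdges k m univ)) ^ 2 := by
  rw [← pow_add, ← pow_mul]
  refine pow_le_pow_of_le_one h0 h1 ?_
  have h2 := card_union_add_card_inter (copyEdges k X) (copyEdges k Y)
  rw [card_copyEdges hX, card_copyEdges hY] at h2
  have h3 := (card_le_card (copyEdges_inter_subset (k := k) hXY)).trans card_image_le
  omega

theorem patternEdges_agreeSet_nonempty {X Y : Fin m → V} (hXY : ∀ u v, X u = Y v → u = v)
    (h : ¬ Disjoint (copyEdges k X) (copyEdges k Y)) :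
    (patternEdges k m (agreeSet X Y)).Nonempty := by
  obtain ⟨e, he⟩ := Finset.nonempty_iff_ne_empty.2 fun h0 => h (disjoint_iff_inter_eq_empty.2 h0)
  exact Finset.image_nonempty.1 ⟨e, copyEdges_inter_subset hXY he⟩

namespace IsPlacement

variable {W : κ → Fin m → Finset V}

theorem card_agree_mul_le (hW : IsPlacement k N W) (i : κ) (X : Fin m → V) (J : Finset (Fin m)) :
    #{Y ∈ Fintype.piFinset (W i) | agreeSet X Y = J} * N ^ #(J ∩ innerPos k m) ≤
      N ^ #(innerPos k m) := by
  have h1 : #{Y ∈ Fintype.piFinset (W i) | agreeSet X Y = J} ≤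
      #(Fintype.piFinset fun u => if u ∈ J then {X u} else W i u) := by
    refine card_le_card fun Y hY => ?_
    obtain ⟨hY, hJ⟩ := mem_filter.1 hY
    refine Fintype.mem_piFinset.2 fun u => ?_
    split_ifs with hu
    · rw [← hJ] at hu
      simpa using (mem_filter.1 hu).2.symm
    · exact Fintype.mem_piFinset.1 hY u
  have h2 : #(Fintype.piFinset fun u => if u ∈ J then {X u} else W i u) ≤
      N ^ #(innerPos k m \ J) := by
    rw [Fintype.card_piFinset, ← prod_const, ← prod_subset (subset_univ (innerPos k m \ J))]
    · refine prod_le_prod' fun u hu => ?_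
      obtain ⟨hu1, hu2⟩ := mem_sdiff.1 hu
      simp [hu1, hu2, hW.card_eq]
    · intro u _ hu
      by_cases huJ : u ∈ J
      · simp [huJ]
      · have : u ∉ innerPos k m := fun h => hu (mem_sdiff.2 ⟨h, huJ⟩)
        simp [huJ, hW.card_eq, this]
  calc _ ≤ N ^ #(innerPos k m \ J) * N ^ #(J ∩ innerPos k m) := Nat.mul_le_mul_right _ (h1.trans h2)
    _ = N ^ #(innerPos k m) := by
        rw [← pow_add, inter_comm, card_sdiff_add_card_inter]

/-- Sort the `Y` by their agreement set `J`, one of `2 ^ m`. Prescribing `Y` on `J` divides the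
number of choices by `N ^ #(J ∩ innerPos k m)`, while the shared edges gain at most a factor `q ^
(-#(patternEdges k m J))`; `γ` bounds the product of these two effects. -/
theorem sum_overlap_le (hW : IsPlacement k N W) {q : ℝ} (hq0 : 0 < q) (hq1 : q ≤ 1) (hN : 0 < N)
    {i j : κ} {X : Fin m → V} (hX : X ∈ Fintype.piFinset (W i)) {γ : ℝ} (hγ : 0 < γ)
    (hJ : ∀ Y ∈ Fintype.piFinset (W j), (patternEdges k m (agreeSet X Y)).Nonempty →
      γ ≤ (N : ℝ) ^ #(agreeSet X Y ∩ innerPos k m) * q ^ #(patternEdges k m (agreeSet X Y))) :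
    ∑ Y ∈ Fintype.piFinset (W j) with ¬ Disjoint (copyEdges k X) (copyEdges k Y),
        q ^ #(copyEdges k X ∪ copyEdges k Y) ≤
      2 ^ m * ((N : ℝ) ^ #(innerPos k m) * (q ^ #(patternEdges k m univ)) ^ 2 / γ) := by
  set F := {Y ∈ Fintype.piFinset (W j) | ¬ Disjoint (copyEdges k X) (copyEdges k Y)}
  set A := (N : ℝ) ^ #(innerPos k m) * (q ^ #(patternEdges k m univ)) ^ 2 / γ
  have hN' : (0 : ℝ) < N := by exact_mod_cast hN
  have hA : 0 ≤ A := by positivity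
  have hfib : ∀ J : Finset (Fin m), ∑ Y ∈ F with agreeSet X Y = J,
      q ^ #(copyEdges k X ∪ copyEdges k Y) ≤ A := by
    intro J
    rcases (F.filter fun Y => agreeSet X Y = J).eq_empty_or_nonempty with h0 | ⟨Y₀, hY₀⟩
    · rw [h0, sum_empty]
      exact hA
    have hY₀F := mem_filter.1 (mem_filter.1 hY₀).1
    have hY₀J := (mem_filter.1 hY₀).2
    have hγJ := hJ Y₀ hY₀F.1 (patternEdges_agreeSet_nonempty (hW.eq_of_eq hX hY₀F.1) hY₀F.2)
    rw [hY₀J] at hγJ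
    have hterm : ∀ Y ∈ F.filter fun Y => agreeSet X Y = J,
        q ^ #(copyEdges k X ∪ copyEdges k Y) ≤
          (q ^ #(patternEdges k m univ)) ^ 2 / q ^ #(patternEdges k m J) := by
      intro Y hY
      obtain ⟨hYF, hYJ⟩ := mem_filter.1 hY
      have hYW := (mem_filter.1 hYF).1
      rw [le_div_iff₀ (by positivity), ← hYJ]
      exact pow_card_union_mul_le hq0.le hq1 (hW.injective hX) (hW.injective hYW)
        (hW.eq_of_eq hX hYW)
    have hcount : (#(F.filter fun Y => agreeSet X Y = J) : ℝ) ≤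
        (N : ℝ) ^ #(innerPos k m) / (N : ℝ) ^ #(J ∩ innerPos k m) := by
      rw [le_div_iff₀ (by positivity)]
      have h1 : #(F.filter fun Y => agreeSet X Y = J) ≤
          #{Y ∈ Fintype.piFinset (W j) | agreeSet X Y = J} :=
        card_le_card (filter_subset_filter _ (filter_subset _ _))
      exact_mod_cast (Nat.mul_le_mul_right _ h1).trans (hW.card_agree_mul_le j X J)
    calc _ ≤ _ := sum_le_card_nsmul _ _ _ hterm
      _ ≤ (N : ℝ) ^ #(innerPos k m) / (N : ℝ) ^ #(J ∩ innerPos k m) *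
          ((q ^ #(patternEdges k m univ)) ^ 2 / q ^ #(patternEdges k m J)) := by
          rw [nsmul_eq_mul]
          exact mul_le_mul_of_nonneg_right hcount (by positivity)
      _ = (N : ℝ) ^ #(innerPos k m) * (q ^ #(patternEdges k m univ)) ^ 2 /
          ((N : ℝ) ^ #(J ∩ innerPos k m) * q ^ #(patternEdges k m J)) := by
          rw [div_mul_div_comm]
      _ ≤ A := div_le_div_of_nonneg_left (by positivity) hγ hγJ
  calc _ = ∑ J : Finset (Fin m), ∑ Y ∈ F with agreeSet X Y = J,
        q ^ #(copyEdges k X ∪ copyEdges k Y) := (sum_fiberwise _ _ _).symm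
    _ ≤ ∑ _J : Finset (Fin m), A := sum_le_sum fun J _ => hfib J
    _ = 2 ^ m * A := by simp

/-- The probability that none of the linkages in question can be placed is exponentially small. -/
theorem prob_no_copy_le [Fintype V] [DecidableEq κ] (hW : IsPlacement k N W) (p : unitInterval)
    (hp0 : 0 < (p : ℝ)) (hN : 0 < N) {I : Finset κ} (hI : I.Nonempty) {g : ℝ} (hg : 0 < g)
    (hJ : ∀ J : Finset (Fin m), (patternEdges k m J).Nonempty →
      (J ⊆ innerPos k m → #I * g ≤ (N : ℝ) ^ #J * (p : ℝ) ^ #(patternEdges k m J)) ∧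
      ((innerPos k m)ᶜ ⊆ J →
        g ≤ (N : ℝ) ^ #(J ∩ innerPos k m) * (p : ℝ) ^ #(patternEdges k m J))) :
    (SimpleGraph.binomialRandom V p).real
        {G : SimpleGraph V | ∀ i ∈ I, ∀ X ∈ Fintype.piFinset (W i),
          ¬ (copyEdges k X : Set (Sym2 V)) ⊆ G.edgeSet} ≤
      Real.exp (-(#I * (g / 2 ^ (m + 2)))) := by
  classical
  set q := (p : ℝ)
  set s : Finset (Σ _ : κ, Fin m → V) := I.sigma fun i => Fintype.piFinset (W i)
  set E := #(patternEdges k m univ)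
  set L := #(innerPos k m)
  have hI0 : (0 : ℝ) < #I := by exact_mod_cast hI.card_pos
  have hN' : (0 : ℝ) < N := by exact_mod_cast hN
  have hinj : ∀ a ∈ s, Function.Injective a.2 := fun a ha => hW.injective (mem_sigma.1 ha).2
  have hμ : (#I : ℝ) * N ^ L * q ^ E = ∑ a ∈ s, q ^ #(copyEdges k a.2) := by
    rw [sum_congr rfl fun a ha => by rw [card_copyEdges (hinj a ha)], sum_const, card_sigma,
      sum_congr rfl fun i _ => hW.card_piFinset i]
    simp [L, E]
  have hpair : ∀ i ∈ I, ∀ X ∈ Fintype.piFinset (W i), ∀ j ∈ I,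
      ∑ Y ∈ Fintype.piFinset (W j) with ¬ Disjoint (copyEdges k X) (copyEdges k Y),
        q ^ #(copyEdges k X ∪ copyEdges k Y) ≤
      2 ^ m * ((N : ℝ) ^ L * (q ^ E) ^ 2 / g) * ((if j = i then 1 else 0) + 1 / #I) := by
    -- Copies for the same index agree on all end positions, those for different indices on none,
    -- whence the two cases of `hJ`. The weights 1 (at `j = i`) and `1 / #I` (for every `j`) sum to
    -- 2 over `I`.
    intro i hi X hX j hj
    by_cases hij : j = i
    · subst hij
      refine (hW.sum_overlap_le hp0 p.2.2 hN hX hg fun Y hY hne => (hJ _ hne).2 ?_).trans ?_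
      · intro u hu
        refine mem_filter.2 ⟨mem_univ _, ?_⟩
        have hc := hW.card_eq j u
        rw [if_neg (by simpa using hu)] at hc
        exact Finset.card_le_one.1 hc.le _ (Fintype.mem_piFinset.1 hX u) _
          (Fintype.mem_piFinset.1 hY u)
      · rw [if_pos rfl]
        refine le_mul_of_one_le_right (by positivity) ?_
        have : (0 : ℝ) ≤ 1 / #I := by positivity
        linarith
    · refine (hW.sum_overlap_le (γ := #I * g) hp0 p.2.2 hN hX (by positivity)
        fun Y hY hne => ?_).trans_eq ?_
      · have hsub : agreeSet X Y ⊆ innerPos k m := by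
          intro u hu
          by_contra hin
          refine Finset.disjoint_left.1 (hW.disjoint_ends i j (Ne.symm hij) u hin)
            (Fintype.mem_piFinset.1 hX u) ?_
          rw [(mem_filter.1 hu).2]
          exact Fintype.mem_piFinset.1 hY u
        rw [inter_eq_left.2 hsub]
        exact (hJ _ hne).1 hsub
      · rw [if_neg hij]
        field_simp
        ring
  -- Written as a multiple of `μ ^ 2`, so that `μ ^ 2 / (2 * Δ)` collapses to `#I * g / 2 ^ (m +
  -- 2)`.
  have hΔ : ∑ a ∈ s, ∑ b ∈ s with ¬ Disjoint (copyEdges k a.2) (copyEdges k b.2),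
      q ^ #(copyEdges k a.2 ∪ copyEdges k b.2) ≤
      ((#I : ℝ) * N ^ L * q ^ E) ^ 2 * 2 ^ (m + 1) / (#I * g) := by
    have hone : ∀ a ∈ s, ∑ b ∈ s with ¬ Disjoint (copyEdges k a.2) (copyEdges k b.2),
        q ^ #(copyEdges k a.2 ∪ copyEdges k b.2) ≤
        2 ^ m * ((N : ℝ) ^ L * (q ^ E) ^ 2 / g) * 2 := by
      rintro ⟨i, X⟩ ha
      obtain ⟨hi, hX⟩ := mem_sigma.1 ha
      rw [sum_filter, sum_sigma]
      simp only [← sum_filter]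
      refine (sum_le_sum fun j hj => hpair i hi X hX j hj).trans_eq ?_
      rw [← mul_sum, sum_add_distrib, sum_ite_eq', if_pos hi, sum_const, nsmul_eq_mul,
        mul_one_div_cancel hI0.ne']
      norm_num
    refine (sum_le_card_nsmul _ _ _ hone).trans_eq ?_
    rw [card_sigma, sum_congr rfl fun i _ => hW.card_piFinset i, sum_const]
    simp only [smul_eq_mul, nsmul_eq_mul, Nat.cast_mul, Nat.cast_pow]
    field_simp
    ring
  have hj := janson_binomialRandom p s (fun a => copyEdges k a.2)
    (fun a ha => not_isDiag_of_mem_copyEdges (hinj a ha)) hμ hΔ (by positivity)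
  have hset : {G : SimpleGraph V | ∀ i ∈ I, ∀ X ∈ Fintype.piFinset (W i),
      ¬ (copyEdges k X : Set (Sym2 V)) ⊆ G.edgeSet} =
      {G : SimpleGraph V | ∀ a ∈ s, ¬ (copyEdges k a.2 : Set (Sym2 V)) ⊆ G.edgeSet} := by
    ext G
    simp only [Set.mem_ofPred_eq, s, mem_sigma, Sigma.forall]
    exact ⟨fun h i X hX => h i hX.1 X hX.2, fun h i hi X hX => h i X ⟨hi, hX⟩⟩
  rw [hset]
  refine hj.trans_eq ?_
  congr 2
  have : q ^ E ≠ 0 := by positivity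
  field_simp
  ring

end IsPlacement

end CopiesOfPattern

/-! ### Packing in rounds. -/

section Rounds

open Finset MeasureTheory

variable {V κ : Type*} {k m : ℕ}

/-- Weight each set by `x ^ #S` with `x = 1 / (n + 1)` and use `(1 + x) ^ n ≤ e`. -/
theorem card_filter_card_le_le [Fintype V] (K : ℕ) :
    (#{S : Finset V | #S ≤ K} : ℝ) ≤ Real.exp 1 * ((Fintype.card V : ℝ) + 1) ^ K := by
  set n := Fintype.card V
  have hn : (0 : ℝ) < n + 1 := by positivity
  have h1 := Finset.sum_pow_mul_eq_add_pow (1 / ((n : ℝ) + 1)) 1 (univ : Finset V)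
  simp only [one_pow, mul_one, powerset_univ, card_univ] at h1
  have h2 : (1 / ((n : ℝ) + 1) + 1) ^ n ≤ Real.exp 1 := by
    calc (1 / ((n : ℝ) + 1) + 1) ^ n ≤ (Real.exp (1 / ((n : ℝ) + 1))) ^ n :=
          pow_le_pow_left₀ (by positivity) (Real.add_one_le_exp _) _
      _ = Real.exp (n * (1 / ((n : ℝ) + 1))) := (Real.exp_nat_mul _ _).symm
      _ ≤ Real.exp 1 := by
          refine Real.exp_le_exp.2 ?_
          rw [mul_one_div, div_le_one hn]
          linarith
  have h3 : ∀ S ∈ ({S : Finset V | #S ≤ K} : Finset (Finset V)),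
      (1 : ℝ) ≤ ((n : ℝ) + 1) ^ K * (1 / ((n : ℝ) + 1)) ^ #S := by
    intro S hS
    rw [one_div, inv_pow, ← div_eq_mul_inv, one_le_div (by positivity)]
    exact pow_le_pow_right₀ (by linarith [(Nat.cast_nonneg n : (0 : ℝ) ≤ n)]) (mem_filter.1 hS).2
  calc (#{S : Finset V | #S ≤ K} : ℝ)
      = ∑ S : Finset V with #S ≤ K, (1 : ℝ) := by simp
    _ ≤ ∑ S : Finset V with #S ≤ K, ((n : ℝ) + 1) ^ K * (1 / ((n : ℝ) + 1)) ^ #S :=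
        sum_le_sum h3
    _ ≤ ∑ S : Finset V, ((n : ℝ) + 1) ^ K * (1 / ((n : ℝ) + 1)) ^ #S :=
        sum_le_sum_of_subset_of_nonneg (filter_subset _ _) fun _ _ _ => by positivity
    _ = ((n : ℝ) + 1) ^ K * (1 / ((n : ℝ) + 1) + 1) ^ n := by rw [← mul_sum, h1]
    _ ≤ ((n : ℝ) + 1) ^ K * Real.exp 1 := mul_le_mul_of_nonneg_left h2 (by positivity)
    _ = _ := mul_comm _ _

/-- End vertices `E i u` and reservoirs `U r u` of vertices for the position `u` in round `r`,
all disjoint from each other. -/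
structure IsRoundSystem (k : ℕ) (E : κ → Fin m → V) (U : ℕ → Fin m → Finset V) : Prop where
  disjoint : ∀ r s u v, r ≠ s ∨ u ≠ v → Disjoint (U r u) (U s v)
  ends_inj : ∀ i j u v, u ∉ innerPos k m → v ∉ innerPos k m → E i u = E j v → i = j ∧ u = v
  ends_notMem : ∀ i u r v, u ∉ innerPos k m → E i u ∉ U r v

theorem IsRoundSystem.isPlacement {E : κ → Fin m → V} {U : ℕ → Fin m → Finset V}
    (hU : IsRoundSystem k E U) {N r : ℕ} {U' : Fin m → Finset V}
    (hsub : ∀ u, U' u ⊆ U r u) (hcard : ∀ u, #(U' u) = N) :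
    IsPlacement k N fun i u => if u ∈ innerPos k m then U' u else {E i u} where
  disjoint_pos i j u v huv := by
    split_ifs with hu hv hv
    · exact disjoint_of_subset_left (hsub u)
        (disjoint_of_subset_right (hsub v) (hU.disjoint r r u v (Or.inr huv)))
    · exact disjoint_singleton_right.2 fun h => hU.ends_notMem j v r u hv (hsub u h)
    · exact disjoint_singleton_left.2 fun h => hU.ends_notMem i u r v hu (hsub v h)
    · exact disjoint_singleton.2 fun h => huv (hU.ends_inj i j u v hu hv h).2
  disjoint_ends i j hij u hu := by
    rw [if_neg hu, if_neg hu]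
    exact disjoint_singleton.2 fun h => hij (hU.ends_inj i j u u hu hu h).1
  card_eq i u := by
    split_ifs
    · exact hcard u
    · exact card_singleton _

variable [DecidableEq V]

/-- The placement `X` realises the `i`th linkage in `G`, with prescribed end vertices `E i` and
with inner vertices chosen from the sets `U u`, avoiding `S`. -/
structure IsCopyIn (k : ℕ) (E : κ → Fin m → V) (U : Fin m → Finset V) (S : Finset V)
    (G : SimpleGraph V) (i : κ) (X : Fin m → V) : Prop where
  mem : ∀ u ∈ innerPos k m, X u ∈ U u
  notMem : ∀ u ∈ innerPos k m, X u ∉ S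
  eq_end : ∀ u ∉ innerPos k m, X u = E i u
  subset : (copyEdges k X : Set (Sym2 V)) ⊆ G.edgeSet

/-- The graphs in which some nonempty set of linkages cannot be placed at all after the removal of
few vertices. -/
def badGraphs (k M N : ℕ) (E : κ → Fin m → V) (U : Fin m → Finset V) : Set (SimpleGraph V) :=
  {G | ∃ I : Finset κ, I.Nonempty ∧ ∃ S : Finset V, #S ≤ m * M * #I ∧
    (∀ u, N ≤ #(U u \ S)) ∧ ∀ i ∈ I, ∀ X, ¬ IsCopyIn k E U S G i X}

namespace IsRoundSystem

variable {E : κ → Fin m → V} {U : ℕ → Fin m → Finset V}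

/-- Union bound over `I` and `S`: the deleted sets for a given `I` contribute at most `e * z ^ #I`,
and the binomial theorem sums this over nonempty `I`. -/
theorem prob_badGraphs_le [Fintype V] [Fintype κ] [DecidableEq κ] (hU : IsRoundSystem k E U)
    (p : unitInterval) (hp0 : 0 < (p : ℝ)) {M N : ℕ} (hN : 0 < N) (r : ℕ) {g : ℝ} (hg : 0 < g)
    (hJ : ∀ J : Finset (Fin m), (patternEdges k m J).Nonempty →
      (J ⊆ innerPos k m →
        Fintype.card κ * g ≤ (N : ℝ) ^ #J * (p : ℝ) ^ #(patternEdges k m J)) ∧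
      ((innerPos k m)ᶜ ⊆ J →
        g ≤ (N : ℝ) ^ #(J ∩ innerPos k m) * (p : ℝ) ^ #(patternEdges k m J))) :
    (SimpleGraph.binomialRandom V p).real (badGraphs k M N E (U r)) ≤
      Real.exp 1 * ((((Fintype.card V : ℝ) + 1) ^ (m * M) * Real.exp (-(g / 2 ^ (m + 2))) + 1) ^
        Fintype.card κ - 1) := by
  classical
  set n := Fintype.card V
  set z := ((n : ℝ) + 1) ^ (m * M) * Real.exp (-(g / 2 ^ (m + 2)))
  let F : Finset κ → Finset (Finset V) := fun I =>
    {S | #S ≤ m * M * #I ∧ ∀ u, N ≤ #(U r u \ S)}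
  let B : Finset κ → Finset V → Set (SimpleGraph V) := fun I S =>
    {G | ∀ i ∈ I, ∀ X, ¬ IsCopyIn k E (U r) S G i X}
  have hB : ∀ I : Finset κ, I.Nonempty → ∀ S ∈ F I,
      (SimpleGraph.binomialRandom V p).real (B I S) ≤ Real.exp (-(#I * (g / 2 ^ (m + 2)))) := by
    intro I hI S hS
    -- Trim what is left of each reservoir to exactly `N` vertices, as `IsPlacement` demands.
    choose U' hU' hcard using fun u => exists_subset_card_eq ((mem_filter.1 hS).2.2 u)
    have hpl := hU.isPlacement (U' := U') (fun u => (hU' u).trans sdiff_subset) hcard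
    refine le_trans (measureReal_mono ?_ (measure_ne_top _ _))
      (hpl.prob_no_copy_le p hp0 hN hI hg fun J hne => ⟨fun h => ?_, (hJ J hne).2⟩)
    · intro G hG i hi X hX hsub
      have hX' := Fintype.mem_piFinset.1 hX
      refine hG i hi X ⟨fun u hu => ?_, fun u hu => ?_, fun u hu => ?_, hsub⟩
      · have := hX' u
        rw [if_pos hu] at this
        exact (mem_sdiff.1 (hU' u this)).1
      · have := hX' u
        rw [if_pos hu] at this
        exact (mem_sdiff.1 (hU' u this)).2
      · have := hX' u
        rw [if_neg hu] at this
        exact mem_singleton.1 this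
    · refine le_trans (mul_le_mul_of_nonneg_right ?_ hg.le) ((hJ J hne).1 h)
      exact_mod_cast card_le_univ I
  have hsub : badGraphs k M N E (U r) ⊆
      ⋃ I ∈ (univ.erase (∅ : Finset κ)), ⋃ S ∈ F I, B I S := by
    rintro G ⟨I, hI, S, hS, hSU, h⟩
    simp only [Set.mem_iUnion]
    exact ⟨I, by simp [hI.ne_empty], S, mem_filter.2 ⟨mem_univ _, hS, hSU⟩, h⟩
  have hone : ∀ I ∈ univ.erase (∅ : Finset κ),
      (SimpleGraph.binomialRandom V p).real (⋃ S ∈ F I, B I S) ≤ Real.exp 1 * z ^ #I := by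
    intro I hI
    have hI' : I.Nonempty := nonempty_iff_ne_empty.2 (mem_erase.1 hI).1
    refine (measureReal_biUnion_finset_le _ _).trans ?_
    refine (sum_le_card_nsmul _ _ _ (hB I hI')).trans ?_
    have hF : (#(F I) : ℝ) ≤ Real.exp 1 * ((n : ℝ) + 1) ^ (m * M * #I) := by
      refine le_trans ?_ (card_filter_card_le_le _)
      exact_mod_cast card_le_card fun S hS => by
        simp only [mem_filter, mem_univ, true_and]
        exact (mem_filter.1 hS).2.1
    rw [nsmul_eq_mul]
    refine (mul_le_mul_of_nonneg_right hF (Real.exp_pos _).le).trans_eq ?_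
    rw [mul_pow, ← Real.exp_nat_mul, ← pow_mul, mul_assoc, mul_neg]
  calc _ ≤ _ := measureReal_mono hsub (measure_ne_top _ _)
    _ ≤ _ := measureReal_biUnion_finset_le _ _
    _ ≤ ∑ I ∈ univ.erase (∅ : Finset κ), Real.exp 1 * z ^ #I := sum_le_sum hone
    _ = Real.exp 1 * ((z + 1) ^ Fintype.card κ - 1) := by
        have h1 := Finset.sum_pow_mul_eq_add_pow z 1 (univ : Finset κ)
        simp only [one_pow, mul_one, powerset_univ, card_univ] at h1
        rw [← mul_sum, sum_erase_eq_sub (mem_univ _), h1, card_empty, pow_zero]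

/-- Take a maximal packing. If too many linkages were left over, its inner vertices would be a
deletable set for them in the sense of `badGraphs`, and one more linkage would fit. -/
theorem exists_partial_packing [DecidableEq κ] (hU : IsRoundSystem k E U) {M N r : ℕ}
    {G : SimpleGraph V} (hG : G ∉ badGraphs k M N E (U r)) (I : Finset κ)
    (hcard : ∀ u, N + #I ≤ #(U r u)) :
    ∃ I' ⊆ I, M * #I' ≤ #I ∧ ∃ X : κ → Fin m → V,
      (∀ i ∈ I \ I', IsCopyIn k E (U r) ∅ G i (X i)) ∧
      ∀ i ∈ I \ I', ∀ j ∈ I \ I', i ≠ j → ∀ u, X i u ≠ X j u := by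
  classical
  let P : Finset κ → Prop := fun J => ∃ X : κ → Fin m → V,
    (∀ i ∈ J, IsCopyIn k E (U r) ∅ G i (X i)) ∧ ∀ i ∈ J, ∀ j ∈ J, i ≠ j → ∀ u, X i u ≠ X j u
  have hne : (I.powerset.filter P).Nonempty :=
    ⟨∅, mem_filter.2 ⟨empty_mem_powerset I, E, by simp, by simp⟩⟩
  obtain ⟨J, hJ, hmax⟩ := exists_max_image _ Finset.card hne
  obtain ⟨hJI, X, hX, hXd⟩ := mem_filter.1 hJ
  rw [mem_powerset] at hJI
  refine ⟨I \ J, sdiff_subset, ?_, X, ?_⟩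
  swap
  · rw [Finset.sdiff_sdiff_eq_self hJI]
    exact ⟨hX, hXd⟩
  by_contra! hlt
  have hJcard : #J ≤ #I := card_le_card hJI
  have hne' : (I \ J).Nonempty := by
    rw [← card_pos]
    by_contra h0
    rw [Nat.eq_zero_of_not_pos h0] at hlt
    omega
  set S := J.biUnion fun i => (innerPos k m).image (X i)
  have hS : #S ≤ m * M * #(I \ J) := by
    calc #S ≤ #J * m := card_biUnion_le_card_mul _ _ _ fun i _ =>
          card_image_le.trans ((card_le_univ _).trans_eq (Fintype.card_fin m))
      _ ≤ (M * #(I \ J)) * m := Nat.mul_le_mul_right _ (hJcard.trans hlt.le)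
      _ = _ := by ring
  have hSU : ∀ u, N ≤ #(U r u \ S) := by
    intro u
    -- Each packed linkage takes at most one vertex from the reservoir of position `u`.
    have h1 : U r u ∩ S ⊆ J.image fun i => X i u := by
      intro x hx
      obtain ⟨hxU, hxS⟩ := mem_inter.1 hx
      obtain ⟨i, hi, hxi⟩ := mem_biUnion.1 hxS
      obtain ⟨v, hv, rfl⟩ := mem_image.1 hxi
      have huv : u = v := by
        by_contra huv
        exact Finset.disjoint_left.1 (hU.disjoint r r u v (Or.inr huv)) hxU ((hX i hi).mem v hv)
      exact mem_image.2 ⟨i, hi, by rw [huv]⟩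
    have h2 := (card_le_card h1).trans card_image_le
    have h3 := card_sdiff_add_card_inter (U r u) S
    have h4 := hcard u
    omega
  have hex : ∃ i ∈ I \ J, ∃ Y, IsCopyIn k E (U r) S G i Y := by
    by_contra! h
    exact hG ⟨I \ J, hne', S, hS, hSU, h⟩
  obtain ⟨i, hi, Y, hY⟩ := hex
  obtain ⟨hiI, hiJ⟩ := mem_sdiff.1 hi
  have hYX : ∀ j ∈ J, ∀ u, Y u ≠ X j u := by
    intro j hj u heq
    by_cases hu : u ∈ innerPos k m
    · exact hY.notMem u hu (mem_biUnion.2 ⟨j, hj, mem_image.2 ⟨u, hu, heq.symm⟩⟩)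
    · rw [hY.eq_end u hu, (hX j hj).eq_end u hu] at heq
      exact hiJ ((hU.ends_inj i j u u hu hu heq).1 ▸ hj)
  have hins : insert i J ∈ I.powerset.filter P := by
    refine mem_filter.2 ⟨mem_powerset.2 (insert_subset hiI hJI), Function.update X i Y, ?_, ?_⟩
    · intro j hj
      by_cases hji : j = i
      · subst hji
        rw [Function.update_self]
        exact ⟨hY.mem, fun u _ => notMem_empty _, hY.eq_end, hY.subset⟩
      · rw [Function.update_of_ne hji]
        exact hX j ((mem_insert.1 hj).resolve_left hji)
    · intro j hj l hl hjl u
      by_cases hji : j = i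
      · subst hji
        rw [Function.update_self, Function.update_of_ne (Ne.symm hjl)]
        exact hYX l ((mem_insert.1 hl).resolve_left (Ne.symm hjl)) u
      · have hj' := (mem_insert.1 hj).resolve_left hji
        rw [Function.update_of_ne hji]
        by_cases hli : l = i
        · subst hli
          rw [Function.update_self]
          exact (hYX j hj' u).symm
        · rw [Function.update_of_ne hli]
          exact hXd j hj' l ((mem_insert.1 hl).resolve_left hli) hjl u
  have := hmax _ hins
  rw [card_insert_of_notMem hiJ] at this
  omega

theorem exists_packing_step [Fintype κ] [DecidableEq κ] (hU : IsRoundSystem k E U) {M N T : ℕ}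
    {G : SimpleGraph V} (hM : 0 < M) (hG : ∀ r < T, G ∉ badGraphs k M N E (U r))
    (hU0 : ∀ u, N + Fintype.card κ ≤ #(U 0 u)) (hUr : ∀ r, 0 < r → r < T → ∀ u, N + N ≤ #(U r u))
    (hMN : Fintype.card κ ≤ M * N) :
    ∀ r ≤ T, ∃ I : Finset κ, M ^ r * #I ≤ Fintype.card κ ∧ ∃ X : κ → Fin m → V,
      (∀ i ∉ I, ∃ s < r, IsCopyIn k E (U s) ∅ G i (X i)) ∧
      ∀ i ∉ I, ∀ j ∉ I, i ≠ j → ∀ u, X i u ≠ X j u := by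
  intro r
  induction r with
  | zero => exact fun _ => ⟨univ, by simp, E, by simp, by simp⟩
  | succ r ih =>
    intro hr
    obtain ⟨I, hI, X, hX, hXd⟩ := ih (by omega)
    have hcard : ∀ u, N + #I ≤ #(U r u) := by
      intro u
      -- Only round 0 must serve all pairs; afterwards at most `N` remain, because `M * #I ≤ M * N`.
      rcases Nat.eq_zero_or_pos r with rfl | hr0
      · exact (Nat.add_le_add_left (card_le_univ I) N).trans (hU0 u)
      · refine (Nat.add_le_add_left ?_ N).trans (hUr r hr0 (by omega) u)
        have h1 : M * #I ≤ M ^ r * #I :=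
          Nat.mul_le_mul_right _ (Nat.le_self_pow hr0.ne' M)
        exact Nat.le_of_mul_le_mul_left (h1.trans (hI.trans hMN)) hM
    obtain ⟨I', hI'I, hI', Y, hY, hYd⟩ :=
      hU.exists_partial_packing (hG r (by omega)) I hcard
    refine ⟨I', ?_, fun i => if i ∈ I then Y i else X i, fun i hi => ?_,
      fun i hi j hj hij u => ?_⟩
    · calc M ^ (r + 1) * #I' = M ^ r * (M * #I') := by ring
        _ ≤ M ^ r * #I := Nat.mul_le_mul_left _ hI'
        _ ≤ _ := hI
    · by_cases hiI : i ∈ I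
      · simp only [hiI, if_true]
        exact ⟨r, by omega, hY i (mem_sdiff.2 ⟨hiI, hi⟩)⟩
      · simp only [hiI, if_false]
        obtain ⟨s, hs, h⟩ := hX i hiI
        exact ⟨s, by omega, h⟩
    · have hcross : ∀ i ∈ I \ I', ∀ j ∉ I, Y i u ≠ X j u := by
        intro i hi j hj heq
        have hij : i ≠ j := fun h => hj (h ▸ (mem_sdiff.1 hi).1)
        obtain ⟨s, hs, h⟩ := hX j hj
        by_cases hu : u ∈ innerPos k m
        · have h1 := (hY i hi).mem u hu
          rw [heq] at h1
          exact Finset.disjoint_left.1 (hU.disjoint r s u u (Or.inl (by omega))) h1 (h.mem u hu)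
        · rw [(hY i hi).eq_end u hu, h.eq_end u hu] at heq
          exact hij (hU.ends_inj i j u u hu hu heq).1
      by_cases hiI : i ∈ I <;> by_cases hjI : j ∈ I <;> simp only [hiI, hjI, if_true, if_false]
      · exact hYd i (mem_sdiff.2 ⟨hiI, hi⟩) j (mem_sdiff.2 ⟨hjI, hj⟩) hij u
      · exact hcross i (mem_sdiff.2 ⟨hiI, hi⟩) j hjI
      · exact (hcross j (mem_sdiff.2 ⟨hjI, hj⟩) i hiI).symm
      · exact hXd i hiI j hjI hij u

theorem exists_packing [Fintype κ] [DecidableEq κ] (hU : IsRoundSystem k E U) {M N T : ℕ}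
    {G : SimpleGraph V} (hM : 0 < M) (hG : ∀ r < T, G ∉ badGraphs k M N E (U r))
    (hU0 : ∀ u, N + Fintype.card κ ≤ #(U 0 u)) (hUr : ∀ r, 0 < r → r < T → ∀ u, N + N ≤ #(U r u))
    (hMN : Fintype.card κ ≤ M * N) (hMT : Fintype.card κ < M ^ T) :
    ∃ X : κ → Fin m → V, (∀ i, ∀ u ∉ innerPos k m, X i u = E i u) ∧
      (∀ i, (copyEdges k (X i) : Set (Sym2 V)) ⊆ G.edgeSet) ∧
      ∀ i j u v, X i u = X j v → i = j ∧ u = v := by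
  obtain ⟨I, hI, X, hX, hXd⟩ :=
    hU.exists_packing_step hM hG hU0 hUr hMN T le_rfl
  have hI0 : ∀ i, i ∉ I := by
    intro i hi
    have : 1 ≤ #I := card_pos.2 ⟨i, hi⟩
    exact absurd (hMT.trans_le (Nat.le_mul_of_pos_right _ this)) (not_lt.2 hI)
  choose s _ hs using fun i => hX i (hI0 i)
  refine ⟨X, fun i => (hs i).eq_end, fun i => (hs i).subset, fun i j u v huv => ?_⟩
  have hpos : u = v := by
    by_contra hne
    by_cases hu : u ∈ innerPos k m <;> by_cases hv : v ∈ innerPos k m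
    · have h1 := (hs i).mem u hu
      rw [huv] at h1
      exact Finset.disjoint_left.1 (hU.disjoint _ _ u v (Or.inr hne)) h1 ((hs j).mem v hv)
    · have h1 := (hs i).mem u hu
      rw [huv, (hs j).eq_end v hv] at h1
      exact hU.ends_notMem j v _ u hv h1
    · have h1 := (hs j).mem v hv
      rw [← huv, (hs i).eq_end u hu] at h1
      exact hU.ends_notMem i u _ v hu h1
    · rw [(hs i).eq_end u hu, (hs j).eq_end v hv] at huv
      exact hne (hU.ends_inj i j u v hu hv huv).2
  subst hpos
  refine ⟨?_, rfl⟩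
  by_contra hij
  exact hXd i (hI0 i) j (hI0 j) hij u huv

end IsRoundSystem

end Rounds

/-! ### From packed copies to linkages, and the probability bound. -/

section LinkageConstruction

open Finset MeasureTheory

/-- Each step of a walk raises the index by at most one. The converse is not needed, as a copy may
have more edges than the linkage. -/
theorem le_add_of_graphPower_pathGraph_adj {m k : ℕ} {u v : Fin m}
    (h : (graphPower (SimpleGraph.pathGraph m) k).Adj u v) : v.val ≤ u.val + k := by
  have hwalk : ∀ {u v : Fin m} (w : (SimpleGraph.pathGraph m).Walk u v),
      v.val ≤ u.val + w.length := by
    intro u v w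
    induction w with
    | nil => simp
    | cons hadj w ih =>
      have := SimpleGraph.pathGraph_adj.1 hadj
      rw [SimpleGraph.Walk.length_cons]
      omega
  obtain ⟨w, hw⟩ := SimpleGraph.exists_walk_of_edist_ne_top
    (ne_top_of_le_ne_top (ENat.natCast_ne_top k) h.2)
  have h1 : w.length ≤ k := by
    have := h.2
    rw [← hw] at this
    exact_mod_cast this
  exact (hwalk w).trans (Nat.add_le_add_left h1 _)

variable {V : Type*} {f k m : ℕ}

/-- The prescribed end vertices of a linkage on `m` vertices: first `A i`, last `B i`. -/
def linkageEnds (hk : 0 < k) (hm : 2 * k ≤ m) (A B : Fin f → Fin k → V) (i : Fin f) (u : Fin m) :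
    V :=
  if h : u.val < k then A i ⟨u, h⟩ else B i ⟨u - (m - k), by have := u.2; omega⟩

theorem isLinkage_of_copyEdges_subset [DecidableEq V] {G : SimpleGraph V} (hk : 0 < k)
    (hm : 2 * k ≤ m) {A B : Fin f → Fin k → V} {i : Fin f} {X : Fin m → V}
    (hX : Function.Injective X)
    (hE : ∀ u ∉ innerPos k m, X u = linkageEnds hk hm A B i u)
    (hG : (copyEdges k X : Set (Sym2 V)) ⊆ G.edgeSet) :
    ∃ R : G.Subgraph, IsLinkage (A i) (B i) R ∧ R.verts = Set.range X := by
  have hA : ∀ u : Fin m, ∀ h : u.val < k, X u = A i ⟨u, h⟩ := by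
    intro u h
    rw [hE u (by rw [mem_innerPos]; omega), linkageEnds, dif_pos h]
  have hB : ∀ u : Fin m, ∀ h : m ≤ u.val + k,
      X u = B i ⟨u - (m - k), by have := u.2; omega⟩ := by
    intro u h
    rw [hE u (by rw [mem_innerPos]; omega), linkageEnds, dif_neg (by omega)]
  let x : Fin m ↪ V := ⟨X, hX⟩
  have hlt : ∀ u v : Fin m, u.val < v.val → (graphPower (SimpleGraph.pathGraph m) k).Adj u v →
      ¬ (X u ∈ Set.range (A i) ∧ X v ∈ Set.range (A i)) →
      ¬ (X u ∈ Set.range (B i) ∧ X v ∈ Set.range (B i)) → G.Adj (X u) (X v) := by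
    intro u v huv hadj hnA hnB
    have h1 := le_add_of_graphPower_pathGraph_adj hadj
    have h2 : k ≤ v.val := by
      by_contra hlt
      exact hnA ⟨⟨_, (hA u (by omega)).symm⟩, ⟨_, (hA v (by omega)).symm⟩⟩
    have h3 : u.val + k < m := by
      by_contra hlt
      exact hnB ⟨⟨_, (hB u (by omega)).symm⟩, ⟨_, (hB v (by omega)).symm⟩⟩
    refine hG (mem_coe.2 (mem_image.2 ⟨(u, v), mem_patternEdges.2 ?_, rfl⟩))
    exact ⟨mem_univ _, mem_univ _, huv, h1, h2, h3⟩
  refine ⟨{ verts := Set.range X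
            Adj := fun a b => ((graphPower (SimpleGraph.pathGraph m) k).map x).Adj a b ∧
              ¬ (a ∈ Set.range (A i) ∧ b ∈ Set.range (A i)) ∧
              ¬ (a ∈ Set.range (B i) ∧ b ∈ Set.range (B i))
            adj_sub := ?_
            edge_vert := ?_
            symm := ?_ }, ⟨m, hm, x, ?_, ?_, rfl, fun u v => Iff.rfl⟩, rfl⟩
  · rintro a b ⟨hab, hnA, hnB⟩
    obtain ⟨u, v, huv, rfl, rfl⟩ := (SimpleGraph.map_adj ..).1 hab
    rcases lt_trichotomy u.val v.val with h | h | h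
    · exact hlt u v h huv hnA hnB
    · exact absurd (Fin.ext h) huv.1
    · exact (hlt v u h huv.symm (fun h => hnA h.symm) (fun h => hnB h.symm)).symm
  · rintro a b ⟨hab, -⟩
    obtain ⟨u, v, huv, rfl, rfl⟩ := (SimpleGraph.map_adj ..).1 hab
    exact ⟨u, rfl⟩
  · exact ⟨fun a b h => ⟨h.1.symm, fun h' => h.2.1 h'.symm, fun h' => h.2.2 h'.symm⟩⟩
  · intro j
    exact hA ⟨j, by have := j.2; omega⟩ j.2
  · intro j
    have hj := j.2
    refine (hB ⟨m - k + j, by omega⟩ (by simp only; omega)).trans ?_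
    congr 1
    exact Fin.ext (by simp)

theorem hasDisjointLinkages_of_packing [DecidableEq V] {G : SimpleGraph V} (hk : 0 < k)
    (hm : 2 * k ≤ m) {s : ℕ} (hs : m ≤ s) {A B : Fin f → Fin k → V}
    {X : Fin f → Fin m → V} (hE : ∀ i, ∀ u ∉ innerPos k m, X i u = linkageEnds hk hm A B i u)
    (hG : ∀ i, (copyEdges k (X i) : Set (Sym2 V)) ⊆ G.edgeSet)
    (hX : ∀ i j u v, X i u = X j v → i = j ∧ u = v) : HasDisjointLinkages G A B s := by
  choose R hR hRv using fun i =>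
    isLinkage_of_copyEdges_subset hk hm (fun u v h => (hX i i u v h).2) (hE i) (hG i)
  refine ⟨R, hR, fun i => ?_, fun i j hij => ?_⟩
  · rw [hRv, ← Set.image_univ]
    refine (Set.ncard_image_le Set.finite_univ).trans ?_
    rwa [Set.ncard_univ, Nat.card_fin]
  · simp only [hRv, Set.disjoint_left]
    rintro _ ⟨u, rfl⟩ ⟨v, huv⟩
    exact hij (hX j i v u huv).1.symm

/-- Restricted to end positions: at every inner position truncated subtraction gives the junk value
`B i 0`. -/
theorem linkageEnds_injective (hk : 0 < k) (hm : 2 * k ≤ m) {A B : Fin f → Fin k → V}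
    (hAB : AreDisjointSequencePairs A B) (i j : Fin f) (u v : Fin m) (hu : u ∉ innerPos k m)
    (hv : v ∉ innerPos k m) (h : linkageEnds hk hm A B i u = linkageEnds hk hm A B j v) :
    i = j ∧ u = v := by
  obtain ⟨hinj, hdisj⟩ := hAB
  rw [mem_innerPos] at hu hv
  have hu' := u.2
  have hv' := v.2
  unfold linkageEnds at h
  have hcross : ∀ (a b : Fin f ⊕ Fin f) (x y : Fin k),
      Sum.elim A B a x = Sum.elim A B b y → a = b ∧ x = y := by
    intro a b x y hxy
    have hab : a = b := by
      by_contra hab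
      exact Set.disjoint_left.1 (hdisj hab) ⟨x, rfl⟩ ⟨y, hxy.symm⟩
    subst hab
    exact ⟨rfl, hinj a hxy⟩
  split_ifs at h with h1 h2 h2
  · obtain ⟨e1, e2⟩ := hcross (Sum.inl i) (Sum.inl j) _ _ h
    exact ⟨Sum.inl.inj e1, Fin.ext (by simpa using e2)⟩
  · exact absurd (hcross (Sum.inl i) (Sum.inr j) _ _ h).1 (by simp)
  · exact absurd (hcross (Sum.inr i) (Sum.inl j) _ _ h).1 (by simp)
  · obtain ⟨e1, e2⟩ := hcross (Sum.inr i) (Sum.inr j) _ _ h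
    have e3 := congrArg Fin.val e2
    simp only at e3
    exact ⟨Sum.inr.inj e1, Fin.ext (by omega)⟩

/-- All reservoirs come from one injection into the complement of the values of `E`; the summand
`Fin f` enlarges those of round 0. -/
theorem exists_roundSystem [Fintype V] (E : Fin f → Fin m → V)
    (hE : ∀ i j u v, u ∉ innerPos k m → v ∉ innerPos k m → E i u = E j v → i = j ∧ u = v)
    {N T : ℕ} (hT : 0 < T) (hcard : f * m + m * (f + T * (N + N)) ≤ Fintype.card V) :
    ∃ U : ℕ → Fin m → Finset V, IsRoundSystem k E U ∧ (∀ u, N + f ≤ #(U 0 u)) ∧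
      ∀ r, 0 < r → r < T → ∀ u, N + N ≤ #(U r u) := by
  classical
  set P := (univ : Finset (Fin f × Fin m)).image fun x => E x.1 x.2
  have hP : #P ≤ f * m := card_image_le.trans (by simp)
  obtain ⟨φ⟩ : Nonempty (Fin m × (Fin f ⊕ Fin T × Fin (N + N)) ↪ {v // v ∉ P}) := by
    refine Function.Embedding.nonempty_of_card_le ?_
    rw [Fintype.card_subtype_compl]
    simp only [Fintype.card_prod, Fintype.card_sum, Fintype.card_fin, Fintype.card_coe]
    omega
  let ρ : Fin f ⊕ Fin T × Fin (N + N) → ℕ := Sum.elim (fun _ => 0) fun x => x.1.val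
  let ψ : Fin m × (Fin f ⊕ Fin T × Fin (N + N)) ↪ V := φ.trans (Function.Embedding.subtype _)
  let U : ℕ → Fin m → Finset V := fun r u =>
    (univ.filter fun x : Fin m × (Fin f ⊕ Fin T × Fin (N + N)) => x.1 = u ∧ ρ x.2 = r).map ψ
  refine ⟨U, ⟨fun r s u v h => ?_, hE, fun i u r v _ h => ?_⟩, fun u => ?_,
    fun r _ hr u => ?_⟩
  · rw [Finset.disjoint_left]
    intro a ha hb
    obtain ⟨x, hx, rfl⟩ := mem_map.1 ha
    obtain ⟨y, hy, hxy⟩ := mem_map.1 hb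
    have hyx : y = x := ψ.injective hxy
    subst hyx
    obtain ⟨-, h1, h2⟩ := mem_filter.1 hx
    obtain ⟨-, h3, h4⟩ := mem_filter.1 hy
    rcases h with h | h
    · exact h (h2.symm.trans h4)
    · exact h (h1.symm.trans h3)
  · obtain ⟨x, -, hx⟩ := mem_map.1 h
    refine (φ x).2 ?_
    change ψ x ∈ P
    rw [hx]
    exact mem_image.2 ⟨(i, u), mem_univ _, rfl⟩
  · rw [card_map]
    let τ : Fin f ⊕ Fin (N + N) → Fin m × (Fin f ⊕ Fin T × Fin (N + N)) := fun y =>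
      (u, Sum.map id (fun a => (⟨0, hT⟩, a)) y)
    have hτ : Function.Injective τ := fun a b hab =>
      (Function.injective_id.sumMap (Prod.mk_right_injective _)) (Prod.mk.inj hab).2
    calc N + f ≤ #(univ.image τ) := by
          rw [card_image_of_injective _ hτ, card_univ]
          simp only [Fintype.card_sum, Fintype.card_fin]
          omega
      _ ≤ _ := card_le_card fun x hx => by
          obtain ⟨y, -, rfl⟩ := mem_image.1 hx
          refine mem_filter.2 ⟨mem_univ _, rfl, ?_⟩
          rcases y with y | y <;> rfl
  · rw [card_map]
    let τ : Fin (N + N) → Fin m × (Fin f ⊕ Fin T × Fin (N + N)) := fun a =>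
      (u, Sum.inr (⟨r, hr⟩, a))
    have hτ : Function.Injective τ := fun a b hab => by simpa [τ] using hab
    calc N + N = #(univ.image τ) := by
          rw [card_image_of_injective _ hτ, card_univ, Fintype.card_fin]
      _ ≤ _ := card_le_card fun x hx => by
          obtain ⟨y, -, rfl⟩ := mem_image.1 hx
          exact mem_filter.2 ⟨mem_univ _, rfl, rfl⟩

theorem one_sub_le_prob_hasDisjointLinkages [Fintype V] [DecidableEq V] (hk : 0 < k)
    (hm : 2 * k ≤ m) {s : ℕ} (hs : m ≤ s) {A B : Fin f → Fin k → V}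
    (hAB : AreDisjointSequencePairs A B) {M N T : ℕ} (hM : 0 < M) (hN : 0 < N) (hT : 0 < T)
    (hcard : f * m + m * (f + T * (N + N)) ≤ Fintype.card V) (hMN : f ≤ M * N) (hMT : f < M ^ T)
    (p : unitInterval) (hp0 : 0 < (p : ℝ)) {g : ℝ} (hg : 0 < g)
    (hJ : ∀ J : Finset (Fin m), (patternEdges k m J).Nonempty →
      (J ⊆ innerPos k m → f * g ≤ (N : ℝ) ^ #J * (p : ℝ) ^ #(patternEdges k m J)) ∧
      ((innerPos k m)ᶜ ⊆ J →
        g ≤ (N : ℝ) ^ #(J ∩ innerPos k m) * (p : ℝ) ^ #(patternEdges k m J))) :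
    1 - T * (Real.exp 1 * ((((Fintype.card V : ℝ) + 1) ^ (m * M) *
        Real.exp (-(g / 2 ^ (m + 2))) + 1) ^ f - 1)) ≤
      (SimpleGraph.binomialRandom V p).real {G | HasDisjointLinkages G A B s} := by
  obtain ⟨U, hU, hU0, hUr⟩ :=
    exists_roundSystem _ (linkageEnds_injective hk hm hAB) hT hcard
  set bad := ⋃ r ∈ range T, badGraphs k M N (linkageEnds hk hm A B) (U r)
  have hcover : (Set.univ : Set (SimpleGraph V)) ⊆ {G | HasDisjointLinkages G A B s} ∪ bad := by
    intro G _
    by_cases hG : G ∈ bad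
    · exact Or.inr hG
    · left
      simp only [bad, Set.mem_iUnion, not_exists, mem_range] at hG
      obtain ⟨X, hE, hsub, hX⟩ := hU.exists_packing hM hG (by simpa using hU0) hUr
        (by simpa using hMN) (by simpa using hMT)
      exact hasDisjointLinkages_of_packing hk hm hs hE hsub hX
  have hbad : (SimpleGraph.binomialRandom V p).real bad ≤
      T * (Real.exp 1 * ((((Fintype.card V : ℝ) + 1) ^ (m * M) *
        Real.exp (-(g / 2 ^ (m + 2))) + 1) ^ f - 1)) := by
    refine (measureReal_biUnion_finset_le _ _).trans ?_
    refine (sum_le_card_nsmul _ _ _ fun r _ =>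
      hU.prob_badGraphs_le p hp0 hN r hg (by simpa using hJ)).trans_eq ?_
    simp
  have h1 := (measureReal_mono hcover (measure_ne_top (SimpleGraph.binomialRandom V p) _)).trans
    (measureReal_union_le _ _)
  rw [probReal_univ] at h1
  linarith

end LinkageConstruction

/-! ### Numerical estimates. -/

section Asymptotics

open Finset MeasureTheory

/-- The overlap conditions of `prob_no_copy_le` follow from three numerical conditions. -/
theorem pattern_weight_bounds {k h N f : ℕ} (hk : 0 < k) (hh : 0 < h) {q g : ℝ} (hq0 : 0 < q)
    (hq1 : q ≤ 1) (hy : 1 ≤ (N : ℝ) * q ^ k) (hg1 : f * g ≤ N * (N * q ^ k))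
    (hg2 : g ≤ N * q ^ k) (hg3 : g ≤ ((N : ℝ) * q ^ k) ^ h * q ^ (k * k))
    (J : Finset (Fin (k * (h + 2)))) (hJ : (patternEdges k (k * (h + 2)) J).Nonempty) :
    (J ⊆ innerPos k (k * (h + 2)) →
      f * g ≤ (N : ℝ) ^ #J * q ^ #(patternEdges k (k * (h + 2)) J)) ∧
    ((innerPos k (k * (h + 2)))ᶜ ⊆ J →
      g ≤ (N : ℝ) ^ #(J ∩ innerPos k (k * (h + 2))) * q ^ #(patternEdges k (k * (h + 2)) J)) := by
  obtain ⟨e, he⟩ := hJ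
  have he' := mem_patternEdges.1 he
  constructor
  · intro _
    have h2 : 2 ≤ #J := by
      refine Finset.one_lt_card.2 ⟨e.1, he'.1, e.2, he'.2.1, fun heq => ?_⟩
      have := congrArg Fin.val heq
      omega
    have h3 := card_patternEdges_le_of_nonempty (k := k) (J := J) ⟨_, he'.1⟩
    obtain ⟨j, hj⟩ : ∃ j, #J = j + 2 := ⟨#J - 2, by omega⟩
    rw [hj] at h3 ⊢
    calc (f : ℝ) * g ≤ N * (N * q ^ k) := hg1
      _ ≤ N * (N * q ^ k) ^ (j + 1) :=
          mul_le_mul_of_nonneg_left (le_self_pow₀ hy (by omega)) (Nat.cast_nonneg N)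
      _ = (N : ℝ) ^ (j + 2) * q ^ (k * (j + 2 - 1)) := by
          rw [mul_pow, ← pow_mul, show j + 2 - 1 = j + 1 from rfl]
          ring
      _ ≤ _ := mul_le_mul_of_nonneg_left (pow_le_pow_of_le_one hq0.le hq1 h3) (by positivity)
  · intro _
    have hkh : k * (h + 2) = k * h + 2 * k := by ring
    have hkh' : k * 1 ≤ k * h := Nat.mul_le_mul_left k hh
    have h1 : 1 ≤ #(J ∩ innerPos k (k * (h + 2))) := by
      refine card_pos.2 ?_
      by_cases hv : e.2.val + k < k * (h + 2)
      · exact ⟨e.2, mem_inter.2 ⟨he'.2.1, mem_innerPos.2 ⟨he'.2.2.2.2.1, hv⟩⟩⟩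
      · exact ⟨e.1, mem_inter.2 ⟨he'.1, mem_innerPos.2 ⟨by omega, he'.2.2.2.2.2⟩⟩⟩
    set j := #(J ∩ innerPos k (k * (h + 2)))
    -- With fewer than `h` inner positions there is a gap and no loss `q ^ (k * k)`; otherwise `h`
    -- factors `N * q ^ k` compensate for it.
    by_cases hjh : j < h
    · have h3 := card_patternEdges_le_of_card_lt hk hjh
      calc g ≤ N * q ^ k := hg2
        _ ≤ (N * q ^ k) ^ j := le_self_pow₀ hy (by omega)
        _ = (N : ℝ) ^ j * q ^ (k * j) := by rw [mul_pow, ← pow_mul]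
        _ ≤ _ := mul_le_mul_of_nonneg_left (pow_le_pow_of_le_one hq0.le hq1 h3) (by positivity)
    · have h3 := card_patternEdges_le (k := k) J
      calc g ≤ (N * q ^ k) ^ h * q ^ (k * k) := hg3
        _ ≤ (N * q ^ k) ^ j * q ^ (k * k) :=
            mul_le_mul_of_nonneg_right (pow_le_pow_right₀ hy (not_lt.1 hjh)) (by positivity)
        _ = (N : ℝ) ^ j * q ^ (k * j + k * k) := by rw [mul_pow, ← pow_mul, pow_add, mul_assoc]
        _ ≤ _ := mul_le_mul_of_nonneg_left (pow_le_pow_of_le_one hq0.le hq1 h3) (by positivity)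

/-- The three upper bounds on `g` need `θ` to the powers 2, 1 and `h`; since `θ ≤ 1`, the exponent
`h + 2` covers all of them. -/
theorem weight_bounds_of_rpow {k h N f n : ℕ} (hk : 0 < k) {ε θ q : ℝ} (hε : 0 < ε)
    (hh : 1 / ε ≤ h) (hθ0 : 0 < θ) (hθ1 : θ ≤ 1) (hn : 0 < n) (hN : θ * n ≤ N)
    (hq : (n : ℝ) ^ (-(1 / (k : ℝ)) + ε) ≤ q) (hy : 1 ≤ θ * (n : ℝ) ^ (k * ε)) (hf : f ≤ n) :
    1 ≤ (N : ℝ) * q ^ k ∧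
    f * (θ ^ (h + 2) * (n : ℝ) ^ (k * ε)) ≤ N * (N * q ^ k) ∧
    θ ^ (h + 2) * (n : ℝ) ^ (k * ε) ≤ N * q ^ k ∧
    θ ^ (h + 2) * (n : ℝ) ^ (k * ε) ≤ ((N : ℝ) * q ^ k) ^ h * q ^ (k * k) := by
  have hn0 : (0 : ℝ) < n := by exact_mod_cast hn
  have hn1 : (1 : ℝ) ≤ n := by exact_mod_cast hn
  have hk0 : (0 : ℝ) < k := by exact_mod_cast hk
  have hk1 : (1 : ℝ) ≤ k := by exact_mod_cast hk
  have hq0 : 0 < q := (by positivity : (0 : ℝ) < (n : ℝ) ^ (-(1 / (k : ℝ)) + ε)).trans_le hq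
  have hqpow : ∀ j : ℕ, (n : ℝ) ^ ((-(1 / (k : ℝ)) + ε) * j) ≤ q ^ j := by
    intro j
    rw [Real.rpow_mul hn0.le, Real.rpow_natCast]
    exact pow_le_pow_left₀ (by positivity) hq j
  have hyn : θ * (n : ℝ) ^ (k * ε) ≤ N * q ^ k := by
    calc θ * (n : ℝ) ^ (k * ε) = (θ * n) * (n : ℝ) ^ ((-(1 / (k : ℝ)) + ε) * k) := by
          rw [mul_assoc]
          congr 1
          nth_rewrite 2 [← Real.rpow_one (n : ℝ)]
          rw [← Real.rpow_add hn0]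
          congr 1
          field_simp
          ring
      _ ≤ _ := mul_le_mul hN (hqpow k) (by positivity) (by positivity)
  have hθp : ∀ j ≤ h + 2, θ ^ (h + 2) ≤ θ ^ j := fun j hj => pow_le_pow_of_le_one hθ0.le hθ1 hj
  have hnγ : 0 < (n : ℝ) ^ (k * ε) := by positivity
  refine ⟨hy.trans hyn, ?_, ?_, ?_⟩
  · calc (f : ℝ) * (θ ^ (h + 2) * (n : ℝ) ^ (k * ε)) ≤ n * (θ ^ 2 * (n : ℝ) ^ (k * ε)) := by
          have hf' : (f : ℝ) ≤ n := by exact_mod_cast hf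
          have := hθp 2 (by omega)
          gcongr
      _ = (θ * n) * (θ * (n : ℝ) ^ (k * ε)) := by ring
      _ ≤ _ := mul_le_mul hN hyn (by positivity) (by positivity)
  · refine le_trans (mul_le_mul_of_nonneg_right ?_ hnγ.le) hyn
    simpa using hθp 1 (by omega)
  · have hexp : k * ε ≤ k * ε * h + (-(1 / (k : ℝ)) + ε) * ((k * k : ℕ) : ℝ) := by
      have h1 : (1 : ℝ) ≤ ε * h := by
        rw [div_le_iff₀ hε] at hh
        linarith
      have h2 : (-(1 / (k : ℝ)) + ε) * ((k * k : ℕ) : ℝ) = -k + k * (k * ε) := by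
        push_cast
        field_simp
      have h3 : k * 1 ≤ k * (ε * h) := mul_le_mul_of_nonneg_left h1 hk0.le
      have h4 : 1 * (k * ε) ≤ k * (k * ε) := mul_le_mul_of_nonneg_right hk1 (by positivity)
      rw [h2]
      linarith
    calc θ ^ (h + 2) * (n : ℝ) ^ (k * ε)
        ≤ θ ^ h * (n : ℝ) ^ (k * ε * h + (-(1 / (k : ℝ)) + ε) * ((k * k : ℕ) : ℝ)) :=
          mul_le_mul (hθp h (by omega)) (Real.rpow_le_rpow_of_exponent_le hn1 hexp)
            hnγ.le (by positivity)
      _ = (θ * (n : ℝ) ^ (k * ε)) ^ h *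
          (n : ℝ) ^ ((-(1 / (k : ℝ)) + ε) * ((k * k : ℕ) : ℝ)) := by
          rw [Real.rpow_add hn0, Real.rpow_mul hn0.le (k * ε) h, Real.rpow_natCast, mul_pow,
            mul_assoc]
      _ ≤ _ := mul_le_mul (pow_le_pow_left₀ (by positivity) hyn h) (hqpow (k * k))
          (by positivity) (by positivity)

theorem tendsto_rpow_natCast_atTop {γ : ℝ} (hγ : 0 < γ) :
    Tendsto (fun n : ℕ => (n : ℝ) ^ γ) atTop atTop :=
  (tendsto_rpow_atTop hγ).comp tendsto_natCast_atTop_atTop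

/-- The logarithm of the polynomial factors is `O(n^(γ/2) log n)`, which is `o(n^γ)`. -/
theorem tendsto_union_bound (m : ℕ) {c γ : ℝ} (hc : 0 < c) (hγ : 0 < γ) :
    Tendsto (fun n : ℕ => (n : ℝ) *
      (((n : ℝ) + 1) ^ (m * ⌈(n : ℝ) ^ (γ / 2)⌉₊) * Real.exp (-(c * (n : ℝ) ^ γ)))) atTop (𝓝 0) := by
  have hlim : Tendsto (fun n : ℕ => Real.exp (-(c / 2 * (n : ℝ) ^ γ))) atTop (𝓝 0) :=
    Real.tendsto_exp_neg_atTop_nhds_zero.comp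
      ((tendsto_rpow_natCast_atTop hγ).const_mul_atTop (half_pos hc))
  refine squeeze_zero' (Eventually.of_forall fun n => by positivity) ?_ hlim
  have hδ : 0 < c / (4 * (2 * m + 1)) := by positivity
  have hlog := ((isLittleO_log_rpow_atTop (half_pos hγ)).comp_tendsto
    tendsto_natCast_atTop_atTop).bound hδ
  filter_upwards [hlog, eventually_ge_atTop 2] with n hln hn
  have hn2 : (2 : ℝ) ≤ n := by exact_mod_cast hn
  have hn0 : (0 : ℝ) < n := by linarith
  set x := (n : ℝ) ^ (γ / 2)
  have hx1 : 1 ≤ x := Real.one_le_rpow (by linarith) (by positivity)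
  have hxx : (n : ℝ) ^ γ = x * x := by
    rw [← Real.rpow_add hn0]
    ring_nf
  have hl : Real.log n ≤ c / (4 * (2 * m + 1)) * x := by
    have h1 : ‖x‖ = x := Real.norm_of_nonneg (by linarith)
    simp only [Function.comp_apply] at hln
    rw [h1] at hln
    exact (le_abs_self _).trans hln
  have hl0 : 0 ≤ Real.log n := Real.log_nonneg (by linarith)
  have hl1 : Real.log ((n : ℝ) + 1) ≤ 2 * Real.log n := by
    have : 2 * Real.log n = Real.log ((n : ℝ) ^ 2) := by simp
    rw [this]
    exact Real.log_le_log (by positivity) (by nlinarith)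
  have hM : (⌈x⌉₊ : ℝ) ≤ 2 * x := by
    have := (Nat.ceil_lt_add_one (a := x) (by linarith)).le
    linarith
  have hcoef : ((m * ⌈x⌉₊ : ℕ) : ℝ) + 1 ≤ (2 * m + 1) * x := by
    push_cast
    have : (m : ℝ) * ⌈x⌉₊ ≤ m * (2 * x) := mul_le_mul_of_nonneg_left hM (Nat.cast_nonneg m)
    linarith
  calc (n : ℝ) * (((n : ℝ) + 1) ^ (m * ⌈x⌉₊) * Real.exp (-(c * (n : ℝ) ^ γ)))
      ≤ ((n : ℝ) + 1) * (((n : ℝ) + 1) ^ (m * ⌈x⌉₊) * Real.exp (-(c * (n : ℝ) ^ γ))) :=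
        mul_le_mul_of_nonneg_right (by linarith) (by positivity)
    _ = Real.exp ((((m * ⌈x⌉₊ : ℕ) : ℝ) + 1) * Real.log ((n : ℝ) + 1) - c * (n : ℝ) ^ γ) := by
        rw [Real.exp_sub, Real.exp_neg, div_eq_mul_inv, ← mul_assoc]
        congr 1
        rw [show ((m * ⌈x⌉₊ : ℕ) : ℝ) + 1 = ((m * ⌈x⌉₊ + 1 : ℕ) : ℝ) by push_cast; ring,
          Real.exp_nat_mul, Real.exp_log (by positivity), pow_succ, mul_comm]
    _ ≤ Real.exp (-(c / 2 * (n : ℝ) ^ γ)) := by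
        refine Real.exp_le_exp.2 ?_
        have h1 : (((m * ⌈x⌉₊ : ℕ) : ℝ) + 1) * Real.log ((n : ℝ) + 1) ≤
            ((2 * m + 1) * x) * (2 * (c / (4 * (2 * m + 1)) * x)) :=
          mul_le_mul hcoef (hl1.trans (by linarith)) (Real.log_nonneg (by linarith))
            (by positivity)
        have h2 : ((2 * m + 1) * x) * (2 * (c / (4 * (2 * m + 1)) * x)) = c / 2 * (x * x) := by
          field_simp
          ring
        rw [hxx]
        linarith

end Asymptotics

/-! ### Choice of parameters and conclusion. -/

theorem lemma4p2 (k : ℕ) (hk : 2 ≤ k) (ε : ℝ) (hε : 0 < ε) (hεk : ε < 1 / (k : ℝ))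
    (p : ℕ → unitInterval)
    (hp : ∀ᶠ n : ℕ in atTop, (n : ℝ) ^ (-(1 / (k : ℝ)) + ε) ≤ (p n : ℝ))
    (hp0 : Tendsto (fun n : ℕ => (p n : ℝ)) atTop (𝓝 0))
    (f : ℕ → ℕ)
    (hf : ∀ᶠ n : ℕ in atTop, (f n : ℝ) ≤ ε * (n : ℝ) / (60 * (k : ℝ)))
    (A B : (n : ℕ) → Fin (f n) → Fin k → Fin n)
    (hAB : ∀ᶠ n : ℕ in atTop, AreDisjointSequencePairs (A n) (B n)) :
    Tendsto
      (fun n : ℕ => SimpleGraph.binomialRandom (Fin n) (p n)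
        {G : SimpleGraph (Fin n) | HasDisjointLinkages G (A n) (B n) ⌈30 * (k : ℝ) / ε⌉₊})
      atTop (𝓝 1) := by
  classical
  set h := ⌈1 / ε⌉₊
  set m := k * (h + 2) with hm
  set γ := (k : ℝ) * ε
  -- Large enough that `(n ^ (γ / 2)) ^ T ≥ n`, which exceeds `f n`.
  set T := ⌈2 / γ⌉₊ + 1
  have hk0 : 0 < k := by omega
  have hk2 : (2 : ℝ) ≤ k := by exact_mod_cast hk
  have hkpos : (0 : ℝ) < k := by linarith
  have hε2 : ε ≤ 1 / 2 := hεk.le.trans (one_div_le_one_div_of_le two_pos hk2)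
  have hε_inv : 0 < 1 / ε := by positivity
  have hh : 0 < h := Nat.ceil_pos.2 hε_inv
  have hγ : 0 < γ := by positivity
  have hm0 : 0 < m := by positivity
  have hm1 : (1 : ℝ) ≤ m := by exact_mod_cast hm0
  have hT0 : 0 < T := Nat.succ_pos _
  have hT1 : (1 : ℝ) ≤ T := by exact_mod_cast hT0
  have hTγ : 1 ≤ γ / 2 * T := by
    have h1 : 2 / γ ≤ T := (Nat.le_ceil _).trans (by simp [T])
    rw [div_le_iff₀ hγ] at h1
    linarith
  have hmε : (m : ℝ) ≤ k * (1 / ε + 3) := by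
    have h1 := (Nat.ceil_lt_add_one hε_inv.le).le
    rw [hm]
    push_cast
    exact mul_le_mul_of_nonneg_left (by linarith) hkpos.le
  have hms : m ≤ ⌈30 * (k : ℝ) / ε⌉₊ := by
    have h1 : (m : ℝ) ≤ 30 * (k : ℝ) / ε := by
      have h2 : (1 : ℝ) ≤ 1 / ε := by
        rw [le_div_iff₀ hε]
        linarith
      calc (m : ℝ) ≤ k * (1 / ε + 3) := hmε
        _ ≤ k * (30 * (1 / ε)) := mul_le_mul_of_nonneg_left (by linarith) hkpos.le
        _ = 30 * (k : ℝ) / ε := by ring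
    exact_mod_cast h1.trans (Nat.le_ceil _)
  -- Makes the `2 * m * T * N` reservoir vertices of all rounds at most `n / 4`.
  set η : ℝ := 1 / (8 * m * T)
  have hη0 : 0 < η := by positivity
  have hη1 : η ≤ 1 := by
    rw [div_le_one (by positivity)]
    nlinarith
  -- Rounding `η * n` down loses at most half once `η * n ≥ 2`.
  set θ := η / 2
  have hθ0 : 0 < θ := half_pos hη0
  set c := θ ^ (h + 2) / 2 ^ (m + 2)
  have hc : 0 < c := by positivity
  set z : ℕ → ℝ := fun n =>
    ((n : ℝ) + 1) ^ (m * ⌈(n : ℝ) ^ (γ / 2)⌉₊) * Real.exp (-(c * (n : ℝ) ^ γ))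
  have hz : Tendsto (fun n : ℕ => (n : ℝ) * z n) atTop (𝓝 0) := tendsto_union_bound m hc hγ
  have hlower : Tendsto (fun n : ℕ => 1 - T * (Real.exp 1 * (Real.exp ((n : ℝ) * z n) - 1)))
      atTop (𝓝 1) := by
    have h1 : Tendsto (fun n : ℕ => Real.exp ((n : ℝ) * z n)) atTop (𝓝 1) := by
      simpa [Function.comp_def] using (Real.continuous_exp.tendsto 0).comp hz
    simpa using (((h1.sub_const 1).const_mul (Real.exp 1)).const_mul (T : ℝ)).const_sub 1
  have hreal : Tendsto (fun n : ℕ => (SimpleGraph.binomialRandom (Fin n) (p n)).real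
      {G : SimpleGraph (Fin n) | HasDisjointLinkages G (A n) (B n) ⌈30 * (k : ℝ) / ε⌉₊})
      atTop (𝓝 1) := by
    refine tendsto_of_tendsto_of_tendsto_of_le_of_le' hlower tendsto_const_nhds ?_
      (Eventually.of_forall fun n => MeasureTheory.measureReal_le_one)
    filter_upwards [hp, hf, hAB, eventually_gt_atTop 0,
      (tendsto_natCast_atTop_atTop (R := ℝ)).eventually_ge_atTop (2 / η),
      (tendsto_rpow_natCast_atTop hγ).eventually_ge_atTop (1 / θ),
      (tendsto_rpow_natCast_atTop (half_pos hγ)).eventually_ge_atTop (1 / θ)]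
      with n hpn hfn hABn hn hnη hnθ hMθ
    have hn0 : (0 : ℝ) < n := by exact_mod_cast hn
    set N := ⌊η * n⌋₊
    set M := ⌈(n : ℝ) ^ (γ / 2)⌉₊
    have hηn : 2 ≤ η * n := by
      rw [div_le_iff₀ hη0] at hnη
      linarith
    have hNle : (N : ℝ) ≤ η * n := Nat.floor_le (by positivity)
    have hNge : θ * n ≤ N := by
      have h1 := Nat.lt_floor_add_one (η * n)
      have h2 : θ * n = η * n / 2 := by ring
      linarith
    have hN0 : 0 < N := by
      have : (0 : ℝ) < N := lt_of_lt_of_le (by positivity) hNge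
      exact_mod_cast this
    have hM0 : 0 < M := Nat.ceil_pos.2 (by positivity)
    have hMge : (n : ℝ) ^ (γ / 2) ≤ M := Nat.le_ceil _
    -- The constant 60 enters here: the end vertices and the extra vertices of round 0 cost `f * m`
    -- each.
    have hfm : (f n : ℝ) * m ≤ n / 24 := by
      calc (f n : ℝ) * m ≤ (ε * n / (60 * k)) * (k * (1 / ε + 3)) :=
            mul_le_mul hfn hmε (by positivity) (by positivity)
        _ = n * (1 + 3 * ε) / 60 := by field_simp
        _ ≤ n * (1 + 3 * (1 / 2)) / 60 := by gcongr
        _ = n / 24 := by ring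
    have hflt : f n < n := by
      have h1 : (f n : ℝ) * 1 ≤ f n * m := mul_le_mul_of_nonneg_left hm1 (Nat.cast_nonneg _)
      have h2 : (f n : ℝ) < n := by linarith
      exact_mod_cast h2
    have hcard : f n * m + m * (f n + T * (N + N)) ≤ Fintype.card (Fin n) := by
      rw [Fintype.card_fin]
      have h1 : (m : ℝ) * T * N ≤ n / 8 := by
        calc (m : ℝ) * T * N ≤ m * T * (η * n) := by gcongr
          _ = n / 8 := by
            simp only [η]
            field_simp
      have h2 : (f n : ℝ) * m + m * (f n + T * (N + N)) ≤ n := by linarith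
      exact_mod_cast h2
    have hMN : f n ≤ M * N := by
      have h1 : (n : ℝ) ≤ M * N := by
        calc (n : ℝ) = (1 / θ) * (θ * n) := by field_simp
          _ ≤ M * N := mul_le_mul (hMθ.trans hMge) hNge (by positivity) (by positivity)
      exact hflt.le.trans (by exact_mod_cast h1)
    have hMT : f n < M ^ T := by
      have h1 : (n : ℝ) ≤ (M : ℝ) ^ T := by
        calc (n : ℝ) = (n : ℝ) ^ (1 : ℝ) := (Real.rpow_one _).symm
          _ ≤ (n : ℝ) ^ (γ / 2 * T) :=
              Real.rpow_le_rpow_of_exponent_le (by exact_mod_cast hn) hTγ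
          _ = ((n : ℝ) ^ (γ / 2)) ^ T := by rw [Real.rpow_mul hn0.le, Real.rpow_natCast]
          _ ≤ (M : ℝ) ^ T := pow_le_pow_left₀ (by positivity) hMge T
      exact hflt.trans_le (by exact_mod_cast h1)
    have hp0 : 0 < (p n : ℝ) :=
      (by positivity : (0 : ℝ) < (n : ℝ) ^ (-(1 / (k : ℝ)) + ε)).trans_le hpn
    have hy : 1 ≤ θ * (n : ℝ) ^ γ := by
      rw [div_le_iff₀ hθ0] at hnθ
      linarith
    obtain ⟨hy1, hg1, hg2, hg3⟩ := weight_bounds_of_rpow (h := h) hk0 hε (Nat.le_ceil _) hθ0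
      ((half_le_self hη0.le).trans hη1) hn hNge hpn hy hflt.le
    have hmain := one_sub_le_prob_hasDisjointLinkages hk0 (by rw [hm]; nlinarith) hms hABn hM0 hN0
      hT0 hcard hMN hMT (p n) hp0 (g := θ ^ (h + 2) * (n : ℝ) ^ γ) (by positivity)
      (pattern_weight_bounds hk0 hh hp0 (p n).2.2 hy1 hg1 hg2 hg3)
    refine le_trans ?_ hmain
    have hzn : ((Fintype.card (Fin n) : ℝ) + 1) ^ (m * M) *
        Real.exp (-(θ ^ (h + 2) * (n : ℝ) ^ γ / 2 ^ (m + 2))) = z n := by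
      rw [Fintype.card_fin, mul_div_right_comm]
    rw [hzn]
    have hz0 : 0 ≤ z n := by positivity
    have hpow : (z n + 1) ^ f n ≤ Real.exp ((n : ℝ) * z n) := by
      calc (z n + 1) ^ f n ≤ Real.exp (z n) ^ f n :=
            pow_le_pow_left₀ (by positivity) (Real.add_one_le_exp _) _
        _ = Real.exp (f n * z n) := (Real.exp_nat_mul _ _).symm
        _ ≤ _ := Real.exp_le_exp.2
            (mul_le_mul_of_nonneg_right (by exact_mod_cast hflt.le) hz0)
    gcongr
  have hfinal := (ENNReal.continuous_ofReal.tendsto 1).comp hreal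
  simpa [Function.comp_def] using hfinal
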